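/- For a polynomial $p\in\mathbb Z[x]$ let $\#_{\rm odd}(p)$ be the number of its odd coefficients. For integers $n\ge 0$, $r\ge1$ put $$g_r(n)=\#_{\rm odd}\big((1+x+\cdots+x^r)^n\big),\qquad h_r(n)=\#_{\rm odd}\big((1+x+x^r)^n\big),$$ with $f=g_1$ and $g=g_2$. Let $u(n)=\#_{\rm odd}(p_n)$ where $p_0=1$, $p_1=1+x+x^2$, $p_n=(1+x+x^2)p_{n-1}+x^2p_{n-2}$ (Pascal's rhombus), and let $v(n)=\#_{\rm odd}(q_n)$ where $q_0=1$, $q_1=x$, $q_n=xq_{n-1}+q_{n-2}$ (Fibonacci polynomials). For $F$ one of $f,g,g_3,h_3,g_4,h_4,g_5,g_6,u,v$ let $D_0,D_1$ be the matrices listed below, let $\mu_1$ be an eigenvalue of $D_0+D_1$ of maximum modulus, and let $N$ be uniformly distributed on $\{0,1,\dots,n-1\}$, so that $\mathbb E(F(N))=\frac1n\sum_{k=0}^{n-1}F(k)$. Then, as $n\to\infty$, $$\frac{\ln\mathbb E(F(N))}{\ln n}\longrightarrow L_F:=\log_2|\mu_1|-1 .$$ The individual values are as follows. - $f$: $D_0=\begin{pmatrix}1\end{pmatrix}$,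 $D_1=\begin{pmatrix}2\end{pmatrix}$; $3$ is an eigenvalue of $D_0+D_1$ of maximum modulus and $L_f=\log_2(3/2)$. - $g$: $D_0=\begin{pmatrix}1&2\\0&0\end{pmatrix}$, $D_1=\begin{pmatrix}1&2\\1&0\end{pmatrix}$; $1+\sqrt5$ is an eigenvalue of $D_0+D_1$ of maximum modulus and $L_g=\log_2\varphi$ with $\varphi=(1+\sqrt5)/2$. - $g_3$: $D_0=\begin{pmatrix}1&2&0\\0&0&1\\0&0&0\end{pmatrix}$, $D_1=\begin{pmatrix}0&0&0\\2&0&0\\0&1&2\end{pmatrix}$; $3$ is an eigenvalue of $D_0+D_1$ of maximum modulus and $L_{g_3}=\log_2(3/2)$. - $h_3$: $D_0=\begin{pmatrix}1&2&1&0\\0&0&1&1\\0&0&0&0\\0&0&0&0\end{pmatrix}$, $D_1=\begin{pmatrix}1&1&1&0\\1&0&0&1\\0&1&0&0\\0&0&1&1\end{pmatrix}$; every eigenvalue of $D_0+D_1$ has minimal polynomial $\xi^4-3\xi^3-2\xi^2+2\xi+4$ over $\mathbb Q$, and $L_{h_3}=0.7274509132400228143266172\dots$. - $g_4$: $D_0=\begin{pmatrix}1&1&2&0\\0&0&0&0\\0&1&0&2\\0&0&0&0\end{pmatrix}$,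 $D_1=\begin{pmatrix}0&1&2&0\\1&0&0&0\\1&0&0&2\\0&1&0&0\end{pmatrix}$; every eigenvalue of $D_0+D_1$ has minimal polynomial $\xi^4-\xi^3-6\xi^2-4\xi-16$ over $\mathbb Q$, and $L_{g_4}=0.7896418505307685639015472\dots$. - $h_4$: $D_0=\begin{pmatrix}1&0&2&0&1&2&1&1\\0&0&0&0&0&0&0&0\\0&1&0&2&1&0&1&1\\0&0&0&0&0&0&0&0\\0&0&0&0&0&0&0&0\\0&0&0&0&0&0&0&0\\0&0&0&0&0&0&0&0\\0&0&0&0&0&0&0&0\end{pmatrix}$, $D_1=\begin{pmatrix}1&0&1&0&0&1&0&0\\1&0&0&0&0&0&0&0\\0&1&0&1&1&0&0&1\\0&1&0&0&0&0&0&0\\0&0&1&0&0&0&0&1\\0&0&0&1&0&0&1&0\\0&0&0&0&1&0&0&0\\0&0&0&0&0&1&1&0\end{pmatrix}$; $L_{h_4}=0.736\dots$. - $g_5$: $D_0=\begin{pmatrix}1&1&2&2&0&0\\0&0&0&0&0&0\\0&1&0&0&1&1\\0&0&0&0&0&0\\0&0&0&0&0&0\\0&0&0&0&1&0\end{pmatrix}$,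 $D_1=\begin{pmatrix}0&0&0&0&0&0\\2&2&0&0&0&0\\0&0&0&0&0&0\\0&0&1&1&2&2\\0&0&0&1&0&0\\0&0&0&0&0&0\end{pmatrix}$; every eigenvalue of $D_0+D_1$ has minimal polynomial $\xi^6-4\xi^5+\xi^4-\xi^3+8\xi^2+11\xi+8$ over $\mathbb Q$, and $L_{g_5}=0.8194694621655401465959376\dots$. - $g_6$: $D_0=\begin{pmatrix}1&0&1&2&0&0\\0&0&0&0&0&0\\0&0&0&0&1&2\\0&2&1&0&1&0\\0&0&0&0&0&0\\0&0&0&0&0&0\end{pmatrix}$, $D_1=\begin{pmatrix}0&0&0&2&1&0\\1&0&0&0&0&0\\1&0&0&0&0&2\\0&2&1&0&0&0\\0&0&1&0&0&0\\0&0&0&0&1&0\end{pmatrix}$; every eigenvalue of $D_0+D_1$ has minimal polynomial $\xi^6-\xi^5-2\xi^4-28\xi^3+16\xi+64$ over $\mathbb Q$, and $L_{g_6}=0.8317963967344406899938931\dots$. - $u$: $D_0=\begin{pmatrix}0&1&0&0&0\\1&0&2&0&0\\0&0&0&0&0\\0&1&0&0&1\\0&0&0&2&1\end{pmatrix}$,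 $D_1=\begin{pmatrix}1&0&2&0&0\\0&0&0&2&1\\1&1&0&0&0\\0&0&0&0&0\\0&1&0&0&0\end{pmatrix}$; $(3+\sqrt{17})/2$ is an eigenvalue of $D_0+D_1$ of maximum modulus and $L_u=\log_2\frac{3+\sqrt{17}}4$. - $v$: $D_0=\begin{pmatrix}1&0\\1&1\end{pmatrix}$, $D_1=\begin{pmatrix}1&1\\0&1\end{pmatrix}$; $3$ is an eigenvalue of $D_0+D_1$ of maximum modulus and $L_v=\log_2(3/2)$. (The decimals are truncated: the displayed digits are the leading decimal digits of the limit.) -/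

import Mathlib

open Filter Topology Polynomial
open scoped BigOperators

noncomputable section

namespace OddEntries

/-- The number of odd coefficients of an integer polynomial. -/
def oddCount (p : ℤ[X]) : ℕ := (p.support.filter fun i => Odd (p.coeff i)).card

/-- `g_r(n)`: the number of odd coefficients of `(1 + x + ⋯ + x^r)^n`. -/
def gCount (r n : ℕ) : ℕ := oddCount ((∑ i ∈ Finset.range (r + 1), (X : ℤ[X]) ^ i) ^ n)

/-- `h_r(n)`: the number of odd coefficients of `(1 + x + x^r)^n`. -/
def hCount (r n : ℕ) : ℕ := oddCount ((1 + X + X ^ r : ℤ[X]) ^ n)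

/-- The polynomials of Pascal's rhombus. -/
def rhombusPoly : ℕ → ℤ[X]
  | 0 => 1
  | 1 => 1 + X + X ^ 2
  | n + 2 => (1 + X + X ^ 2) * rhombusPoly (n + 1) + X ^ 2 * rhombusPoly n

/-- `u(n)`: the number of odd coefficients of the `n`-th rhombus polynomial. -/
def uCount (n : ℕ) : ℕ := oddCount (rhombusPoly n)

/-- The Fibonacci polynomials, indexed so that `p₀ = 1` and `p₁ = x`. -/
def fibPoly : ℕ → ℤ[X]
  | 0 => 1
  | 1 => X
  | n + 2 => X * fibPoly (n + 1) + fibPoly n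

/-- `v(n)`: the number of odd coefficients of the `n`-th Fibonacci polynomial. -/
def vCount (n : ℕ) : ℕ := oddCount (fibPoly n)

/-- `ln E(F(N)) / ln n → L`, where `N` is uniform on `{0, …, n - 1}`; `𝔼 k ∈ Finset.range n, F k`
is the average of `F` over this set. -/
def HasAverageExponent (F : ℕ → ℕ) (L : ℝ) : Prop :=
  Tendsto (fun n : ℕ => Real.log (𝔼 k ∈ Finset.range n, (F k : ℝ)) / Real.log n) atTop (𝓝 L)

/-- `μ` is an eigenvalue of the complex matrix `M`. -/
def IsEigenvalue {m : ℕ} (M : Matrix (Fin m) (Fin m) ℂ) (μ : ℂ) : Prop :=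
  Module.End.HasEigenvalue (Matrix.toLin' M) μ

/-- `μ` is an eigenvalue of `M` of maximum modulus. -/
def IsDominantEigenvalue {m : ℕ} (M : Matrix (Fin m) (Fin m) ℂ) (μ : ℂ) : Prop :=
  IsEigenvalue M μ ∧ ∀ ν : ℂ, IsEigenvalue M ν → ‖ν‖ ≤ ‖μ‖

/-- `F` has average growth exponent `L`, and `L = log₂ |μ| - 1` for the eigenvalues `μ` of maximum
modulus of `M` (of which there is at least one). -/
def HasSpectralExponent {m : ℕ} (F : ℕ → ℕ) (M : Matrix (Fin m) (Fin m) ℂ) (L : ℝ) : Prop :=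
  HasAverageExponent F L ∧ (∃ μ : ℂ, IsDominantEigenvalue M μ) ∧
    ∀ μ : ℂ, IsDominantEigenvalue M μ → L = Real.logb 2 ‖μ‖ - 1

/-! The transfer matrices `D₀`, `D₁` of the families. -/

def fD0 : Matrix (Fin 1) (Fin 1) ℂ := !![1]
def fD1 : Matrix (Fin 1) (Fin 1) ℂ := !![2]

def gD0 : Matrix (Fin 2) (Fin 2) ℂ := !![1, 2; 0, 0]
def gD1 : Matrix (Fin 2) (Fin 2) ℂ := !![1, 2; 1, 0]

def g3D0 : Matrix (Fin 3) (Fin 3) ℂ := !![1, 2, 0; 0, 0, 1; 0, 0, 0]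
def g3D1 : Matrix (Fin 3) (Fin 3) ℂ := !![0, 0, 0; 2, 0, 0; 0, 1, 2]

def h3D0 : Matrix (Fin 4) (Fin 4) ℂ := !![1, 2, 1, 0; 0, 0, 1, 1; 0, 0, 0, 0; 0, 0, 0, 0]
def h3D1 : Matrix (Fin 4) (Fin 4) ℂ := !![1, 1, 1, 0; 1, 0, 0, 1; 0, 1, 0, 0; 0, 0, 1, 1]

def g4D0 : Matrix (Fin 4) (Fin 4) ℂ := !![1, 1, 2, 0; 0, 0, 0, 0; 0, 1, 0, 2; 0, 0, 0, 0]
def g4D1 : Matrix (Fin 4) (Fin 4) ℂ := !![0, 1, 2, 0; 1, 0, 0, 0; 1, 0, 0, 2; 0, 1, 0, 0]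

def h4D0 : Matrix (Fin 8) (Fin 8) ℂ :=
  !![1, 0, 2, 0, 1, 2, 1, 1;
     0, 0, 0, 0, 0, 0, 0, 0;
     0, 1, 0, 2, 1, 0, 1, 1;
     0, 0, 0, 0, 0, 0, 0, 0;
     0, 0, 0, 0, 0, 0, 0, 0;
     0, 0, 0, 0, 0, 0, 0, 0;
     0, 0, 0, 0, 0, 0, 0, 0;
     0, 0, 0, 0, 0, 0, 0, 0]
def h4D1 : Matrix (Fin 8) (Fin 8) ℂ :=
  !![1, 0, 1, 0, 0, 1, 0, 0;
     1, 0, 0, 0, 0, 0, 0, 0;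
     0, 1, 0, 1, 1, 0, 0, 1;
     0, 1, 0, 0, 0, 0, 0, 0;
     0, 0, 1, 0, 0, 0, 0, 1;
     0, 0, 0, 1, 0, 0, 1, 0;
     0, 0, 0, 0, 1, 0, 0, 0;
     0, 0, 0, 0, 0, 1, 1, 0]

def g5D0 : Matrix (Fin 6) (Fin 6) ℂ :=
  !![1, 1, 2, 2, 0, 0;
     0, 0, 0, 0, 0, 0;
     0, 1, 0, 0, 1, 1;
     0, 0, 0, 0, 0, 0;
     0, 0, 0, 0, 0, 0;
     0, 0, 0, 0, 1, 0]
def g5D1 : Matrix (Fin 6) (Fin 6) ℂ :=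
  !![0, 0, 0, 0, 0, 0;
     2, 2, 0, 0, 0, 0;
     0, 0, 0, 0, 0, 0;
     0, 0, 1, 1, 2, 2;
     0, 0, 0, 1, 0, 0;
     0, 0, 0, 0, 0, 0]

def g6D0 : Matrix (Fin 6) (Fin 6) ℂ :=
  !![1, 0, 1, 2, 0, 0;
     0, 0, 0, 0, 0, 0;
     0, 0, 0, 0, 1, 2;
     0, 2, 1, 0, 1, 0;
     0, 0, 0, 0, 0, 0;
     0, 0, 0, 0, 0, 0]
def g6D1 : Matrix (Fin 6) (Fin 6) ℂ :=
  !![0, 0, 0, 2, 1, 0;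
     1, 0, 0, 0, 0, 0;
     1, 0, 0, 0, 0, 2;
     0, 2, 1, 0, 0, 0;
     0, 0, 1, 0, 0, 0;
     0, 0, 0, 0, 1, 0]

def uD0 : Matrix (Fin 5) (Fin 5) ℂ :=
  !![0, 1, 0, 0, 0;
     1, 0, 2, 0, 0;
     0, 0, 0, 0, 0;
     0, 1, 0, 0, 1;
     0, 0, 0, 2, 1]
def uD1 : Matrix (Fin 5) (Fin 5) ℂ :=
  !![1, 0, 2, 0, 0;
     0, 0, 0, 2, 1;
     1, 1, 0, 0, 0;
     0, 0, 0, 0, 0;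
     0, 1, 0, 0, 0]

def vD0 : Matrix (Fin 2) (Fin 2) ℂ := !![1, 0; 1, 1]
def vD1 : Matrix (Fin 2) (Fin 2) ℂ := !![1, 1; 0, 1]

end OddEntries

end

open OddEntries

open scoped Matrix

noncomputable section

namespace OddEntries

/-! Modulo 2, squaring is the substitution of x² for x. A polynomial over the field with two
elements splits as E(x²) + x·O(x²), and its number of terms is that of E plus that of O, because the
exponents have opposite parity. For a power family with base p, the even and odd parts of P·p^(2n)
are P_even·p^n and P_odd·p^n, and P·p^(2n+1) = (P·p)·p^(2n). Starting from P = 1, only finitely many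
multipliers P arise, up to powers of x and, for palindromic p, up to reversal. Hence the vector v(n)
of the term counts of P_i·p^n satisfies v(2n) = v(n)D₀ and v(2n+1) = v(n)D₁
(`hasSpectralExponent_of_pow`). The rhombus and Fibonacci polynomials are Lucas sequences modulo 2.
Their doubling formulas contain only squares, so they lead to recursions of the same kind.

Summing over n < 2^k gives vectors T(k) with T(k+1) = T(k)(D₀ + D₁). If w is a positive left
eigenvector of this nonnegative matrix with eigenvalue λ, then T(k) lies between constant multiples
of λ^k·w, and monotonicity of the summatory function carries the exponent from powers of two to all
n. The same w shows that λ dominates every eigenvalue, so λ need not be compared with the other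
roots of its polynomial (`hasSpectralExponent_of_recursion`).

What remains is finite: a positive w for each family, irreducibility of four polynomials, and
rational enclosures of λ and of its logarithm. -/

/-! ### Growth exponents from positive left eigenvectors -/

/-- A monotone sequence whose values at the powers of two are comparable to `lam ^ k` has average
exponent `log₂ lam - 1`. -/
theorem tendsto_log_div_log_of_dyadic {S : ℕ → ℝ} (hS : Monotone S) {lam c C : ℝ} {K : ℕ}
    (hlam : 1 < lam) (hc : 0 < c) (hlow : ∀ k, K ≤ k → c * lam ^ k ≤ S (2 ^ k))
    (hup : ∀ k, K ≤ k → S (2 ^ k) ≤ C * lam ^ k) :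
    Tendsto (fun n : ℕ => Real.log (S n / n) / Real.log n) atTop
      (𝓝 (Real.logb 2 lam - 1)) := by
  set a := Real.logb 2 lam with ha
  have hl2 : 0 < Real.log 2 := Real.log_pos one_lt_two
  have hla : Real.log lam = a * Real.log 2 := by
    rw [ha, Real.logb, div_mul_cancel₀ _ hl2.ne']
  have ha0 : 0 < a := Real.logb_pos one_lt_two hlam
  have hlam0 : 0 < lam := by linarith
  have hC : 0 < C := by
    have := (hlow K le_rfl).trans (hup K le_rfl)
    have h2 := pow_pos hlam0 K
    nlinarith
  -- With 2^k ≤ n ≤ 2^(k+1), monotonicity traps S n between values at powers of two, so log S n − a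
  -- log n stays bounded. Division by log n removes it in the limit.
  have key : ∀ n : ℕ, 2 ^ (K + 1) ≤ n → 0 < S n ∧
      Real.log c - a * Real.log 2 ≤ Real.log (S n) - a * Real.log n ∧
      Real.log (S n) - a * Real.log n ≤ Real.log C + a * Real.log 2 := by
    intro n hn
    have hn0 : n ≠ 0 := by have := Nat.two_pow_pos (K + 1); omega
    set k := Nat.log 2 n with hk
    have hKk : K + 1 ≤ k := Nat.le_log_of_pow_le (by norm_num) hn
    have h1 : 2 ^ k ≤ n := Nat.pow_log_le_self 2 hn0
    have h2 : n ≤ 2 ^ (k + 1) := (Nat.lt_pow_succ_log_self (by norm_num) n).le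
    have hnpos : (0 : ℝ) < n := by exact_mod_cast Nat.pos_of_ne_zero hn0
    have h1' : k * Real.log 2 ≤ Real.log n := by
      rw [← Real.log_pow]; exact Real.log_le_log (by positivity) (by exact_mod_cast h1)
    have h2' : Real.log n ≤ (k + 1) * Real.log 2 := by
      have := Real.log_le_log hnpos (show (n : ℝ) ≤ 2 ^ (k + 1) by exact_mod_cast h2)
      rw [Real.log_pow] at this; exact_mod_cast this
    have hlo : c * lam ^ k ≤ S n := (hlow k (by omega)).trans (hS h1)
    have hhi : S n ≤ C * lam ^ (k + 1) := (hS h2).trans (hup (k + 1) (by omega))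
    have hp : 0 < c * lam ^ k := by positivity
    have hSn : 0 < S n := hp.trans_le hlo
    have hlo' := Real.log_le_log hp hlo
    have hhi' := Real.log_le_log hSn hhi
    rw [Real.log_mul hc.ne' (by positivity), Real.log_pow, hla] at hlo'
    rw [Real.log_mul hC.ne' (by positivity), Real.log_pow, hla] at hhi'
    push_cast at hhi'
    refine ⟨hSn, ?_, ?_⟩
    · nlinarith
    · nlinarith
  have hlog : Tendsto (fun n : ℕ => Real.log (n : ℝ)) atTop atTop :=
    Real.tendsto_log_atTop.comp tendsto_natCast_atTop_atTop
  have hlim : ∀ b : ℝ, Tendsto (fun n : ℕ => b / Real.log (n : ℝ) + (a - 1)) atTop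
      (𝓝 (a - 1)) := fun b => by
    simpa using (hlog.const_div_atTop b).add_const (a - 1)
  have hev : ∀ᶠ n : ℕ in atTop, 2 ^ (K + 1) ≤ n ∧ 0 < Real.log (n : ℝ) :=
    (eventually_ge_atTop _).and (hlog.eventually_gt_atTop 0)
  have hform : ∀ n : ℕ, 0 < S n → 0 < Real.log (n : ℝ) →
      Real.log (S n / n) / Real.log n =
        (Real.log (S n) - a * Real.log n) / Real.log n + (a - 1) := by
    intro n h1 h2
    have hn : (n : ℝ) ≠ 0 := by rintro h; rw [h] at h2; simp at h2
    rw [Real.log_div h1.ne' hn]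
    field_simp
    ring
  refine tendsto_of_tendsto_of_tendsto_of_le_of_le' (hlim (Real.log c - a * Real.log 2))
    (hlim (Real.log C + a * Real.log 2)) ?_ ?_
  · filter_upwards [hev] with n hn
    obtain ⟨h1, h2, h3⟩ := key n hn.1
    have := hn.2
    rw [hform n h1 hn.2]
    gcongr
  · filter_upwards [hev] with n hn
    obtain ⟨h1, h2, h3⟩ := key n hn.1
    have := hn.2
    rw [hform n h1 hn.2]
    gcongr

theorem sum_range_two_mul {R : Type*} [AddCommMonoid R] (f : ℕ → R) (N : ℕ) :
    ∑ n ∈ Finset.range (2 * N), f n = ∑ n ∈ Finset.range N, (f (2 * n) + f (2 * n + 1)) := by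
  induction N with
  | zero => simp
  | succ N ih =>
    rw [show 2 * (N + 1) = 2 * N + 1 + 1 by ring, Finset.sum_range_succ, Finset.sum_range_succ, ih,
      Finset.sum_range_succ, add_assoc]

variable {m : ℕ}

/-- A vector comparable to a positive left eigenvector of a nonnegative matrix stays comparable to
it along the orbit. -/
theorem orbit_bounds {A : Matrix (Fin m) (Fin m) ℝ} (hA : ∀ i j, 0 ≤ A i j)
    {w : Fin m → ℝ} {lam : ℝ} (hw : w ᵥ* A = lam • w) {T : ℕ → Fin m → ℝ}
    (hT : ∀ k, T (k + 1) = T k ᵥ* A) {K : ℕ} {c C : ℝ}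
    (hc : ∀ i, c * w i ≤ T K i) (hC : ∀ i, T K i ≤ C * w i) (k : ℕ) (i : Fin m) :
    c * lam ^ k * w i ≤ T (K + k) i ∧ T (K + k) i ≤ C * lam ^ k * w i := by
  induction k generalizing i with
  | zero => simpa using ⟨hc i, hC i⟩
  | succ k ih =>
    have hwi : ∑ j, w j * A j i = lam * w i := by
      have := congrFun hw i
      simpa [Matrix.vecMul, dotProduct] using this
    have e : T (K + (k + 1)) i = ∑ j, T (K + k) j * A j i := by
      rw [← add_assoc, hT]; rfl
    have e' : ∀ b : ℝ, b * lam ^ (k + 1) * w i = ∑ j, b * lam ^ k * w j * A j i := by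
      intro b
      rw [pow_succ, show b * (lam ^ k * lam) * w i = b * lam ^ k * (lam * w i) by ring, ← hwi,
        Finset.mul_sum]
      exact Finset.sum_congr rfl fun j _ => by ring
    rw [e, e', e']
    exact ⟨Finset.sum_le_sum fun j _ => mul_le_mul_of_nonneg_right (ih j).1 (hA j i),
      Finset.sum_le_sum fun j _ => mul_le_mul_of_nonneg_right (ih j).2 (hA j i)⟩

/-- The eigenvalue of a positive left eigenvector of a nonnegative matrix is dominant. -/
theorem isDominantEigenvalue_of_pos_vecMul {A : Matrix (Fin m) (Fin m) ℝ}
    (hA : ∀ i j, 0 ≤ A i j) [NeZero m] {w : Fin m → ℝ} (hpos : ∀ i, 0 < w i) {lam : ℝ}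
    (hlam : 0 ≤ lam) (hw : w ᵥ* A = lam • w) :
    IsDominantEigenvalue (A.map (fun x : ℝ => (x : ℂ))) (lam : ℂ) := by
  have hwi : ∀ i, ∑ j, w j * A j i = lam * w i := fun i => by
    have := congrFun hw i
    simpa [Matrix.vecMul, dotProduct] using this
  constructor
  · have h1 : ∃ x ≠ 0, x ᵥ* (A.map (fun x : ℝ => (x : ℂ)) - (lam : ℂ) • 1) = 0 := by
      refine ⟨fun i => (w i : ℂ), fun h => ?_, ?_⟩
      · have := congrFun h 0
        simp [(hpos 0).ne'] at this
      · ext i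
        have := congrArg (fun x : ℝ => (x : ℂ)) (hwi i)
        simp only [Matrix.vecMul_sub, Matrix.vecMul_smul, Matrix.vecMul_one, Pi.sub_apply,
          Pi.smul_apply, Pi.zero_apply, smul_eq_mul, sub_eq_zero]
        push_cast at this
        simpa [Matrix.vecMul, dotProduct] using this
    -- A left kernel vector yields a right one, since each exists exactly when the determinant
    -- vanishes.
    obtain ⟨x, hx, hx'⟩ := Matrix.exists_mulVec_eq_zero_iff.2
      (Matrix.exists_vecMul_eq_zero_iff.1 h1)
    refine Module.End.hasEigenvalue_of_hasEigenvector (x := x)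
      (Module.End.hasEigenvector_iff.2 ⟨?_, hx⟩)
    rw [Module.End.mem_eigenspace_iff, Matrix.toLin'_apply]
    simpa [Matrix.sub_mulVec, Matrix.smul_mulVec, sub_eq_zero] using hx'
  · intro ν hν
    obtain ⟨x, hx⟩ := hν.exists_hasEigenvector
    have hx1 := hx.apply_eq_smul
    have hx0 := hx.2
    rw [Matrix.toLin'_apply] at hx1
    have hle : ∀ i, ‖ν‖ * ‖x i‖ ≤ ∑ j, A i j * ‖x j‖ := fun i => by
      have := congrFun hx1 i
      rw [← norm_mul, ← smul_eq_mul, ← Pi.smul_apply, ← this]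
      rw [Matrix.mulVec, dotProduct]
      refine (norm_sum_le _ _).trans (Finset.sum_le_sum fun j _ => ?_)
      simp [abs_of_nonneg (hA i j)]
    -- Pairing the entrywise inequality |ν||x| ≤ A|x| with w turns A into λ; the pairing of w with
    -- |x| is positive, so it cancels.
    have hsum : ‖ν‖ * ∑ i, w i * ‖x i‖ ≤ lam * ∑ i, w i * ‖x i‖ := by
      calc ‖ν‖ * ∑ i, w i * ‖x i‖ = ∑ i, w i * (‖ν‖ * ‖x i‖) := by
            rw [Finset.mul_sum]; exact Finset.sum_congr rfl fun i _ => by ring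
        _ ≤ ∑ i, w i * ∑ j, A i j * ‖x j‖ :=
            Finset.sum_le_sum fun i _ => mul_le_mul_of_nonneg_left (hle i) (hpos i).le
        _ = ∑ j, (∑ i, w i * A i j) * ‖x j‖ := by
            simp_rw [Finset.mul_sum, Finset.sum_mul]
            rw [Finset.sum_comm]
            exact Finset.sum_congr rfl fun i _ => Finset.sum_congr rfl fun j _ => by ring
        _ = lam * ∑ i, w i * ‖x i‖ := by
            rw [Finset.mul_sum]
            exact Finset.sum_congr rfl fun i _ => by rw [hwi]; ring
    have hpos' : 0 < ∑ i, w i * ‖x i‖ := by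
      obtain ⟨i, hi⟩ := Function.ne_iff.1 hx0
      refine Finset.sum_pos' (fun i _ => mul_nonneg (hpos i).le (norm_nonneg _)) ⟨i, by simp, ?_⟩
      exact mul_pos (hpos i) (norm_pos_iff.2 hi)
    simpa [abs_of_nonneg hlam] using le_of_mul_le_mul_right hsum hpos'

/-- A count that satisfies binary recursions with transfer matrices `A₀`, `A₁` has the growth
exponent given by a positive left eigenvector of `A₀ + A₁`. -/
theorem hasSpectralExponent_of_recursion [NeZero m] {F : ℕ → ℕ} {v : ℕ → Fin m → ℕ}
    {A₀ A₁ : Matrix (Fin m) (Fin m) ℕ} (hF : ∀ n, v n 0 = F n)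
    (h₀ : ∀ n, v (2 * n) = v n ᵥ* A₀) (h₁ : ∀ n, v (2 * n + 1) = v n ᵥ* A₁)
    (hv : ∀ i, ∃ n, 0 < v n i) {D₀ D₁ : Matrix (Fin m) (Fin m) ℂ}
    (hD₀ : D₀ = A₀.map (fun x : ℕ => (x : ℂ))) (hD₁ : D₁ = A₁.map (fun x : ℕ => (x : ℂ)))
    {w : Fin m → ℝ} (hpos : ∀ i, 0 < w i) {lam : ℝ} (hlam : 1 < lam)
    (hw : w ᵥ* (A₀ + A₁).map (fun x : ℕ => (x : ℝ)) = lam • w) :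
    HasSpectralExponent F (D₀ + D₁) (Real.logb 2 lam - 1) ∧
      IsDominantEigenvalue (D₀ + D₁) (lam : ℂ) := by
  set A : Matrix (Fin m) (Fin m) ℝ := (A₀ + A₁).map (fun x : ℕ => (x : ℝ)) with hAdef
  have hA : ∀ i j, 0 ≤ A i j := fun i j => Nat.cast_nonneg _
  have hdom : IsDominantEigenvalue (D₀ + D₁) (lam : ℂ) := by
    have hM : D₀ + D₁ = A.map (fun x : ℝ => (x : ℂ)) := by
      rw [hD₀, hD₁]; ext i j; simp [hAdef]
    rw [hM]
    exact isDominantEigenvalue_of_pos_vecMul hA hpos (by linarith) hw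
  refine ⟨⟨?_, ⟨_, hdom⟩, fun μ hμ => ?_⟩, hdom⟩
  · set T : ℕ → Fin m → ℝ := fun k i => ∑ n ∈ Finset.range (2 ^ k), (v n i : ℝ) with hTdef
    have hT : ∀ k, T (k + 1) = T k ᵥ* A := by
      intro k
      ext i
      have e : ∀ n, (v (2 * n) i : ℝ) + v (2 * n + 1) i = ∑ j, (v n j : ℝ) * A j i := by
        intro n
        rw [h₀, h₁]
        simp [Matrix.vecMul, dotProduct, hAdef, mul_add, Finset.sum_add_distrib]
      simp only [hTdef, pow_succ', sum_range_two_mul, e, Matrix.vecMul, dotProduct,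
        Finset.sum_mul]
      rw [Finset.sum_comm]
    -- Each witness satisfies N i ≤ ∑ N < 2^(∑ N), so it occurs in the block sum at K = ∑ N.
    obtain ⟨K, hK⟩ : ∃ K, ∀ i, 0 < T K i := by
      choose N hN using hv
      refine ⟨∑ i, N i, fun i => ?_⟩
      refine Finset.sum_pos' (fun _ _ => Nat.cast_nonneg _) ⟨N i, ?_, by exact_mod_cast hN i⟩
      exact Finset.mem_range.2 ((Finset.single_le_sum (f := N) (fun _ _ => Nat.zero_le _)
        (Finset.mem_univ i)).trans_lt Nat.lt_two_pow_self)
    -- The constants c and C are the least and the greatest of the ratios T K i / w i.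
    obtain ⟨c, hc, hcK⟩ : ∃ c > 0, ∀ i, c * w i ≤ T K i := by
      refine ⟨Finset.univ.inf' Finset.univ_nonempty fun i => T K i / w i, ?_, fun i => ?_⟩
      · rw [gt_iff_lt, Finset.lt_inf'_iff]
        exact fun i _ => div_pos (hK i) (hpos i)
      · rw [← le_div_iff₀ (hpos i)]
        exact Finset.inf'_le _ (Finset.mem_univ i)
    obtain ⟨C, hCK⟩ : ∃ C, ∀ i, T K i ≤ C * w i := by
      refine ⟨Finset.univ.sup' Finset.univ_nonempty fun i => T K i / w i, fun i => ?_⟩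
      rw [← div_le_iff₀ (hpos i)]
      exact Finset.le_sup' (fun i => T K i / w i) (Finset.mem_univ i)
    have hb := orbit_bounds hA hw hT hcK hCK
    have hlam0 : lam ≠ 0 := by linarith
    have hmono : Monotone fun N : ℕ => ∑ k ∈ Finset.range N, (F k : ℝ) := fun a b hab =>
      Finset.sum_le_sum_of_subset_of_nonneg (Finset.range_mono hab)
        fun _ _ _ => Nat.cast_nonneg _
    have hlk : ∀ k, K ≤ k → lam ^ k = lam ^ K * lam ^ (k - K) := fun k hk => by
      rw [← pow_add, Nat.add_sub_cancel' hk]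
    -- The orbit bounds start at K, hence the factor lam ^ K in the denominators; coordinate 0 is
    -- the one that counts F.
    have h := tendsto_log_div_log_of_dyadic (lam := lam) (c := c * w 0 / lam ^ K)
      (C := C * w 0 / lam ^ K) (K := K) hmono hlam
      (div_pos (mul_pos hc (hpos 0)) (pow_pos (by linarith) K))
      (fun k hk => by
        have := (hb (k - K) 0).1
        rw [Nat.add_sub_cancel' hk] at this
        simp only [hTdef, hF] at this
        rw [hlk k hk]
        convert this using 1
        field_simp)
      (fun k hk => by
        have := (hb (k - K) 0).2
        rw [Nat.add_sub_cancel' hk] at this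
        simp only [hTdef, hF] at this
        rw [hlk k hk]
        convert this using 1
        field_simp)
    simpa only [HasAverageExponent, Finset.expect_eq_sum_div_card, Finset.card_range] using h
  · have h : ‖μ‖ = lam := by
      have h1 := hμ.2 _ hdom.1
      have h2 := hdom.2 _ hμ.1
      rw [Complex.norm_real, Real.norm_eq_abs, abs_of_pos (by linarith)] at h1 h2
      exact le_antisymm h2 h1
    rw [h]

/-! ### Term counts over the field with two elements -/

/-- The number of terms of a polynomial over the field with two elements. -/
def termCount (p : (ZMod 2)[X]) : ℕ := p.support.card

/-- Reduction of integer polynomials modulo two. -/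
def modTwo : ℤ[X] →+* (ZMod 2)[X] := mapRingHom (Int.castRingHom (ZMod 2))

theorem oddCount_eq_termCount (p : ℤ[X]) : oddCount p = termCount (modTwo p) := by
  unfold oddCount termCount
  congr 1
  ext i
  simp only [modTwo, Finset.mem_filter, mem_support_iff, coe_mapRingHom, coeff_map, eq_intCast,
    ne_eq]
  rw [ZMod.intCast_zmod_eq_zero_iff_dvd (p.coeff i) 2]
  constructor
  · rintro ⟨-, h⟩ h'
    exact (Int.not_even_iff_odd.2 h) (even_iff_two_dvd.2 h')
  · intro h
    refine ⟨fun h0 => h (by simp [h0]), ?_⟩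
    rw [← Int.not_even_iff_odd, even_iff_two_dvd]
    exact h

theorem termCount_zero : termCount 0 = 0 := by simp [termCount]

theorem termCount_pos {p : (ZMod 2)[X]} (hp : p ≠ 0) : 0 < termCount p := by
  simpa [termCount, Finset.card_pos] using hp

theorem termCount_X_mul (p : (ZMod 2)[X]) : termCount (X * p) = termCount p := by
  unfold termCount
  have h : (X * p).support = p.support.map (addRightEmbedding 1) := by
    ext n
    rcases n with _ | n
    · simp
    · simp [coeff_X_mul]
  rw [h, Finset.card_map]

theorem termCount_reflect (N : ℕ) (p : (ZMod 2)[X]) :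
    termCount (reflect N p) = termCount p := by
  unfold termCount
  rw [reflect_support, Finset.card_image_of_injective _ (revAt N).injective]

/-- The two summands live on even and on odd exponents, so nothing cancels. Every matrix entry of
the recursions comes from this splitting. -/
theorem termCount_expand_add (E O : (ZMod 2)[X]) :
    termCount (expand (ZMod 2) 2 E + X * expand (ZMod 2) 2 O) = termCount E + termCount O := by
  unfold termCount
  have hE : ∀ n, (expand (ZMod 2) 2 E + X * expand (ZMod 2) 2 O).coeff (2 * n) = E.coeff n := by
    intro n
    rw [coeff_add, mul_comm 2 n, coeff_expand_mul two_pos]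
    rcases n with _ | n
    · simp
    · rw [show (n + 1) * 2 = (2 * n + 1) + 1 by ring, coeff_X_mul, coeff_expand two_pos,
        if_neg (by omega), add_zero]
  have hO : ∀ n, (expand (ZMod 2) 2 E + X * expand (ZMod 2) 2 O).coeff (2 * n + 1) =
      O.coeff n := by
    intro n
    rw [coeff_add, coeff_X_mul, mul_comm 2 n, coeff_expand_mul two_pos, coeff_expand two_pos,
      if_neg (by omega), zero_add]
  have h : (expand (ZMod 2) 2 E + X * expand (ZMod 2) 2 O).support =
      E.support.image (fun n => 2 * n) ∪ O.support.image (fun n => 2 * n + 1) := by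
    ext k
    simp only [Finset.mem_union, Finset.mem_image, mem_support_iff]
    obtain ⟨n, rfl | rfl⟩ := Nat.even_or_odd' k
    · rw [hE]
      constructor
      · exact fun h => Or.inl ⟨n, h, rfl⟩
      · rintro (⟨a, ha, h⟩ | ⟨a, ha, h⟩)
        · rwa [show n = a by omega]
        · omega
    · rw [hO]
      constructor
      · exact fun h => Or.inr ⟨n, h, rfl⟩
      · rintro (⟨a, ha, h⟩ | ⟨a, ha, h⟩)
        · omega
        · rwa [show n = a by omega]
  rw [h, Finset.card_union_of_disjoint, Finset.card_image_of_injective,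
    Finset.card_image_of_injective]
  · intro a b; simp
  · intro a b; simp
  · rw [Finset.disjoint_left]
    intro k hk hk'
    simp only [Finset.mem_image] at hk hk'
    obtain ⟨a, -, ha⟩ := hk
    obtain ⟨b, -, hb⟩ := hk'
    omega

/-! ### Polynomials as coefficient lists -/

/-- The polynomial over the field with two elements with a given list of coefficients. -/
def ofBits : List Bool → (ZMod 2)[X]
  | [] => 0
  | b :: l => (if b then 1 else 0) + X * ofBits l

/-- Sum of coefficient lists. -/
def addBits : List Bool → List Bool → List Bool
  | [], l => l
  | a :: k, [] => a :: k
  | a :: k, b :: l => xor a b :: addBits k l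

/-- Product of coefficient lists. -/
def mulBits : List Bool → List Bool → List Bool
  | [], _ => []
  | a :: k, l => addBits (if a then l else []) (false :: mulBits k l)

/-- The lists of even-indexed and of odd-indexed entries. -/
def splitBits : List Bool → List Bool × List Bool
  | [] => ([], [])
  | b :: l => (b :: (splitBits l).2, (splitBits l).1)

/-- Removal of the zeros at both ends of a coefficient list. -/
def trimBits (l : List Bool) : List Bool :=
  ((l.dropWhile (fun b => !b)).reverse.dropWhile (fun b => !b)).reverse

theorem ofBits_addBits (k l : List Bool) : ofBits (addBits k l) = ofBits k + ofBits l := by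
  induction k generalizing l with
  | nil => simp [addBits, ofBits]
  | cons a k ih =>
    rcases l with _ | ⟨b, l⟩
    · simp [addBits, ofBits]
    · simp only [addBits, ofBits, ih]
      have h2 : (2 : (ZMod 2)[X]) = 0 := CharTwo.two_eq_zero
      cases a <;> cases b <;> simp
      · ring
      · ring
      · ring
      · linear_combination -h2

theorem ofBits_mulBits (k l : List Bool) : ofBits (mulBits k l) = ofBits k * ofBits l := by
  induction k with
  | nil => simp [mulBits, ofBits]
  | cons a k ih =>
    rw [mulBits, ofBits_addBits]
    cases a <;> simp [ofBits, ih] <;> ring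

theorem ofBits_splitBits (l : List Bool) :
    ofBits l = expand (ZMod 2) 2 (ofBits (splitBits l).1) +
      X * expand (ZMod 2) 2 (ofBits (splitBits l).2) := by
  induction l with
  | nil => simp [splitBits, ofBits]
  | cons b l ih =>
    simp only [splitBits, ofBits]
    rw [ih]
    cases b <;> simp <;> ring

theorem natDegree_ofBits_le (l : List Bool) : (ofBits l).natDegree ≤ l.length - 1 := by
  induction l with
  | nil => simp [ofBits]
  | cons b l ih =>
    rcases l with _ | ⟨c, l⟩
    · cases b <;> simp [ofBits]
    · rw [ofBits]
      refine (natDegree_add_le _ _).trans (max_le (by cases b <;> simp) ?_)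
      refine natDegree_mul_le.trans ?_
      simp only [natDegree_X, List.length_cons] at *
      omega

theorem ofBits_append (k l : List Bool) :
    ofBits (k ++ l) = ofBits k + X ^ k.length * ofBits l := by
  induction k with
  | nil => simp [ofBits]
  | cons a k ih => simp [ofBits, ih]; ring

theorem coeff_ofBits (l : List Bool) (n : ℕ) :
    (ofBits l).coeff n = if l.getD n false then 1 else 0 := by
  induction l generalizing n with
  | nil => simp [ofBits]
  | cons b l ih =>
    rcases n with _ | n
    · cases b <;> simp [ofBits]
    · cases b <;> simp [ofBits, ih, coeff_one]

theorem ofBits_reverse (l : List Bool) :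
    ofBits l.reverse = reflect (l.length - 1) (ofBits l) := by
  ext n
  rw [coeff_reflect, coeff_ofBits, coeff_ofBits]
  congr 2
  by_cases hn : n < l.length
  · rw [revAt_le (by omega)]
    simp [List.getD, List.getElem?_reverse hn]
  -- Beyond the list, `revAt` fixes the index and both sides read the default `false`. The empty
  -- list is separate because its length minus one truncates to 0.
  · rcases l with _ | ⟨b, l⟩
    · simp
    · rw [revAt_eq_self_of_lt (by simp at *; omega)]
      simp only [List.getD]
      rw [List.getElem?_eq_none (by simp at *; omega), List.getElem?_eq_none (by omega)]

theorem ofBits_ne_zero {l : List Bool} (h : true ∈ l) : ofBits l ≠ 0 := by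
  intro h0
  obtain ⟨n, hn, h⟩ := List.getElem_of_mem h
  have := coeff_ofBits l n
  rw [h0, List.getD_eq_getElem _ _ hn, h] at this
  simp at this

/-- Zeros at the head of the list are factors X, which shift exponents and keep the count; the
cofactor q lets this apply to P·p^n. -/
theorem termCount_ofBits_dropWhile_mul (l : List Bool) (q : (ZMod 2)[X]) :
    termCount (ofBits (l.dropWhile (fun b => !b)) * q) = termCount (ofBits l * q) := by
  induction l with
  | nil => rfl
  | cons b l ih =>
    cases b
    · simp [ofBits, ih, mul_assoc, termCount_X_mul]
    · simp

theorem ofBits_eq_zero_of_all {l : List Bool} (h : ∀ b ∈ l, b = false) : ofBits l = 0 := by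
  ext n
  rw [coeff_ofBits, coeff_zero, if_neg]
  by_cases hn : n < l.length
  · simp [hn, h l[n] (List.getElem_mem hn)]
  · simp [List.getD, List.getElem?_eq_none (not_lt.1 hn)]

theorem ofBits_rdropWhile (l : List Bool) :
    ofBits ((l.reverse.dropWhile (fun b => !b)).reverse) = ofBits l := by
  have h := List.takeWhile_append_dropWhile (p := fun b => !b) (l := l.reverse)
  have h' := congrArg List.reverse h
  rw [List.reverse_append, List.reverse_reverse] at h'
  conv_rhs => rw [← h', ofBits_append]
  rw [ofBits_eq_zero_of_all (l := (List.takeWhile _ _).reverse), mul_zero, add_zero]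
  intro b hb
  have := List.mem_takeWhile_imp (List.mem_reverse.1 hb)
  simpa using this

theorem termCount_ofBits_trimBits_mul (l : List Bool) (q : (ZMod 2)[X]) :
    termCount (ofBits (trimBits l) * q) = termCount (ofBits l * q) := by
  rw [trimBits, ofBits_rdropWhile, termCount_ofBits_dropWhile_mul]

theorem reflect_pow_of_palindrome {p : List Bool} (hp : p.reverse = p) (n : ℕ) :
    reflect (n * (p.length - 1)) (ofBits p ^ n) = ofBits p ^ n := by
  induction n with
  | zero => simp
  | succ n ih =>
    rw [pow_succ, Nat.succ_mul, reflect_mul _ _ _ (natDegree_ofBits_le p), ih, ← ofBits_reverse, hp]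
    exact natDegree_pow_le.trans (Nat.mul_le_mul_left _ (natDegree_ofBits_le p))

/-- A power of a palindrome is fixed by reflection in its formal degree, so reflecting the product
reverses only the factor from l. -/
theorem termCount_ofBits_reverse_mul {p : List Bool} (hp : p.reverse = p) (l : List Bool)
    (n : ℕ) :
    termCount (ofBits l.reverse * ofBits p ^ n) = termCount (ofBits l * ofBits p ^ n) := by
  rw [ofBits_reverse]
  conv_lhs => rw [← reflect_pow_of_palindrome hp n]
  rw [← reflect_mul _ _ (natDegree_ofBits_le l)
    (natDegree_pow_le.trans (Nat.mul_le_mul_left _ (natDegree_ofBits_le p))), termCount_reflect]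

/-! ### Finite systems of states closed under even and odd parts -/

/-- Equality of coefficient lists up to zeros at the ends of the first list and, if `pal` is set,
up to reversal. -/
def SimBits (pal : Bool) (k l : List Bool) : Prop :=
  trimBits k = l ∨ (pal = true ∧ trimBits k = l.reverse)

instance (pal : Bool) (k l : List Bool) : Decidable (SimBits pal k l) :=
  inferInstanceAs (Decidable (_ ∨ _))

/-- The list `k` vanishes or is similar to exactly one of the lists `P i`. -/
def Classified (pal : Bool) (P : Fin m → List Bool) (k : List Bool) : Prop :=
  (trimBits k = [] ∧ ∀ i, ¬ SimBits pal k (P i)) ∨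
    ∃ i, SimBits pal k (P i) ∧ ∀ j, SimBits pal k (P j) → j = i

instance (pal : Bool) (P : Fin m → List Bool) (k : List Bool) : Decidable (Classified pal P k) :=
  inferInstanceAs (Decidable (_ ∨ _))

/-- Uniqueness of the similar state reduces the sum to one term; a list that trims to nothing
represents 0 and matches no state. -/
theorem termCount_of_classified {pal : Bool} {p : List Bool} (hp : pal = true → p.reverse = p)
    {P : Fin m → List Bool} {k : List Bool} (h : Classified pal P k) (n : ℕ) :
    termCount (ofBits k * ofBits p ^ n) =
      ∑ i, termCount (ofBits (P i) * ofBits p ^ n) * if SimBits pal k (P i) then 1 else 0 := by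
  rcases h with ⟨h0, h⟩ | ⟨i, hi, h⟩
  · rw [← termCount_ofBits_trimBits_mul, h0]
    simp [h, ofBits, termCount_zero]
  · rw [Finset.sum_eq_single i]
    · rw [if_pos hi, mul_one, ← termCount_ofBits_trimBits_mul]
      rcases hi with hi | ⟨hpal, hi⟩
      · rw [hi]
      · rw [hi, termCount_ofBits_reverse_mul (hp hpal)]
    · intro j _ hj
      rw [if_neg fun hs => hj (h j hs), mul_zero]
    · simp

/-- The even and the odd part of the list `k` are classified, with multiplicities `c`. -/
def SplitsInto (pal : Bool) (P : Fin m → List Bool) (k : List Bool) (c : Fin m → ℕ) : Prop :=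
  Classified pal P (splitBits k).1 ∧ Classified pal P (splitBits k).2 ∧
    ∀ i, c i = (if SimBits pal (splitBits k).1 (P i) then 1 else 0) +
      if SimBits pal (splitBits k).2 (P i) then 1 else 0

instance (pal : Bool) (P : Fin m → List Bool) (k : List Bool) (c : Fin m → ℕ) :
    Decidable (SplitsInto pal P k c) :=
  inferInstanceAs (Decidable (_ ∧ _ ∧ _))

/-- By Frobenius p^(2n) is p^n evaluated at x². Multiplying by it preserves parity of exponents, so
the halves of k·p^(2n) are the halves of k times p^n. -/
theorem termCount_of_splitsInto {pal : Bool} {p : List Bool} (hp : pal = true → p.reverse = p)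
    {P : Fin m → List Bool} {k : List Bool} {c : Fin m → ℕ} (h : SplitsInto pal P k c) (n : ℕ) :
    termCount (ofBits k * ofBits p ^ (2 * n)) =
      ∑ i, termCount (ofBits (P i) * ofBits p ^ n) * c i := by
  have e : ofBits k * ofBits p ^ (2 * n) =
      expand (ZMod 2) 2 (ofBits (splitBits k).1 * ofBits p ^ n) +
        X * expand (ZMod 2) 2 (ofBits (splitBits k).2 * ofBits p ^ n) := by
    have h2 : ofBits p ^ (2 * n) = expand (ZMod 2) 2 (ofBits p ^ n) := by
      rw [ZMod.expand_card, ← pow_mul, mul_comm]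
    rw [h2, ofBits_splitBits k, map_mul, map_mul]
    ring
  rw [e, termCount_expand_add, termCount_of_classified hp h.1, termCount_of_classified hp h.2.1,
    ← Finset.sum_add_distrib]
  exact Finset.sum_congr rfl fun i _ => by rw [h.2.2 i, mul_add]

/-- The growth exponent of the number of odd coefficients of the powers of a polynomial, from a
finite system of states closed under taking even and odd parts. -/
theorem hasSpectralExponent_of_pow [NeZero m] {F : ℕ → ℕ} {q : ℤ[X]} (hF : ∀ n, F n = oddCount (q ^ n))
    (pal : Bool) (p : List Bool) (P : Fin m → List Bool) {A₀ A₁ : Matrix (Fin m) (Fin m) ℕ}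
    (hq : modTwo q = ofBits p) (hp : pal = true → p.reverse = p) (hP : P 0 = [true])
    (hP' : ∀ i, true ∈ P i)
    (h₀ : ∀ j, SplitsInto pal P (P j) (fun i => A₀ i j))
    (h₁ : ∀ j, SplitsInto pal P (mulBits (P j) p) (fun i => A₁ i j))
    {D₀ D₁ : Matrix (Fin m) (Fin m) ℂ}
    (hD₀ : D₀ = A₀.map (fun x : ℕ => (x : ℂ))) (hD₁ : D₁ = A₁.map (fun x : ℕ => (x : ℂ)))
    {w : Fin m → ℝ} (hpos : ∀ i, 0 < w i) {lam : ℝ} (hlam : 1 < lam)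
    (hw : w ᵥ* (A₀ + A₁).map (fun x : ℕ => (x : ℝ)) = lam • w) :
    HasSpectralExponent F (D₀ + D₁) (Real.logb 2 lam - 1) ∧
      IsDominantEigenvalue (D₀ + D₁) (lam : ℂ) := by
  refine hasSpectralExponent_of_recursion
    (v := fun n i => termCount (ofBits (P i) * ofBits p ^ n)) (fun n => ?_) (fun n => ?_)
    (fun n => ?_) (fun i => ⟨0, ?_⟩) hD₀ hD₁ hpos hlam hw
  · rw [hF, oddCount_eq_termCount, map_pow, hq, hP]
    simp [ofBits]
  · ext j
    exact termCount_of_splitsInto hp (h₀ j) n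
  · ext j
    -- The extra factor of the odd power is absorbed into the multiplier: P_j·p^(2n+1) =
    -- (P_j·p)·p^(2n).
    have := termCount_of_splitsInto hp (h₁ j) n
    rw [ofBits_mulBits, mul_assoc, ← pow_succ'] at this
    exact this
  · simpa using termCount_pos (ofBits_ne_zero (hP' i))

/-! ### Lucas sequences modulo two: Fibonacci polynomials and Pascal's rhombus -/

theorem termCount_sq_add (e o : (ZMod 2)[X]) :
    termCount (e ^ 2 + X * o ^ 2) = termCount e + termCount o := by
  rw [← termCount_expand_add, ZMod.expand_card, ZMod.expand_card]

theorem termCount_sq (e : (ZMod 2)[X]) : termCount (e ^ 2) = termCount e := by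
  simpa [termCount_zero] using termCount_sq_add e 0

theorem two_eq_zero_modTwo : (2 : (ZMod 2)[X]) = 0 := CharTwo.two_eq_zero

/-- The Lucas sequence with parameters `a`, `b` over the field with two elements. -/
def lucasSeq (a b : (ZMod 2)[X]) : ℕ → (ZMod 2)[X]
  | 0 => 0
  | 1 => 1
  | n + 2 => a * lucasSeq a b (n + 1) + b * lucasSeq a b n

theorem lucasSeq_add_two (a b : (ZMod 2)[X]) (n : ℕ) :
    lucasSeq a b (n + 2) = a * lucasSeq a b (n + 1) + b * lucasSeq a b n := rfl

/-- Over the integers U(2n+1) = U(n+1)² + b·U(n)² and U(2n) = U(n)(2U(n+1) − a·U(n)); modulo 2 the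
second becomes a·U(n)². The two formulas are proved jointly because each step of the recurrence uses
both. -/
theorem lucasSeq_double_add (a b : (ZMod 2)[X]) (n : ℕ) :
    lucasSeq a b (2 * n + 1) = lucasSeq a b (n + 1) ^ 2 + b * lucasSeq a b n ^ 2 ∧
      lucasSeq a b (2 * n + 2) = a * lucasSeq a b (n + 1) ^ 2 := by
  have h2 := two_eq_zero_modTwo
  induction n with
  | zero => simp [lucasSeq]
  | succ n ih =>
    have h3 : lucasSeq a b (2 * (n + 1) + 1) =
        lucasSeq a b (n + 1 + 1) ^ 2 + b * lucasSeq a b (n + 1) ^ 2 := by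
      rw [show 2 * (n + 1) + 1 = 2 * n + 1 + 2 by ring, lucasSeq, ih.1, ih.2, lucasSeq]
      linear_combination -(a * lucasSeq a b (n + 1) * (b * lucasSeq a b n)) * h2
    refine ⟨h3, ?_⟩
    rw [lucasSeq, h3, show 2 * (n + 1) = 2 * n + 2 by ring, ih.2]
    linear_combination (a * b * lucasSeq a b (n + 1) ^ 2) * h2

theorem lucasSeq_two_mul_add_one (a b : (ZMod 2)[X]) (n : ℕ) :
    lucasSeq a b (2 * n + 1) = lucasSeq a b (n + 1) ^ 2 + b * lucasSeq a b n ^ 2 :=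
  (lucasSeq_double_add a b n).1

theorem lucasSeq_two_mul (a b : (ZMod 2)[X]) (n : ℕ) :
    lucasSeq a b (2 * n) = a * lucasSeq a b n ^ 2 := by
  rcases n with _ | n
  · simp [lucasSeq]
  · exact (lucasSeq_double_add a b n).2

theorem modTwo_fibPoly (n : ℕ) : modTwo (fibPoly n) = lucasSeq X 1 (n + 1) := by
  induction n using Nat.strong_induction_on with
  | _ n ih =>
    rcases n with _ | _ | n
    · simp [fibPoly, lucasSeq]
    · simp [fibPoly, lucasSeq, modTwo]
    · rw [fibPoly, map_add, map_mul, ih (n + 1) (by omega), ih n (by omega),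
        lucasSeq_add_two _ _ (n + 1)]
      simp [modTwo]

theorem modTwo_rhombusPoly (n : ℕ) :
    modTwo (rhombusPoly n) = lucasSeq (1 + X + X ^ 2) (X ^ 2) (n + 1) := by
  induction n using Nat.strong_induction_on with
  | _ n ih =>
    rcases n with _ | _ | n
    · simp [rhombusPoly, lucasSeq]
    · simp [rhombusPoly, lucasSeq, modTwo]
    · rw [rhombusPoly, map_add, map_mul, map_mul, ih (n + 1) (by omega), ih n (by omega),
        lucasSeq_add_two _ _ (n + 1)]
      simp [modTwo]

/-- Consecutive Fibonacci polynomials are of opposite parity. -/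
theorem termCount_lucasSeq_X_one_add (n : ℕ) :
    termCount (lucasSeq X 1 (n + 1) + lucasSeq X 1 n) =
      termCount (lucasSeq X 1 (n + 1)) + termCount (lucasSeq X 1 n) := by
  -- Of two neighbours one is a square and the other X times a square, hence their supports are
  -- disjoint. Additivity of squares modulo 2 propagates this.
  have h : ∃ s t : (ZMod 2)[X],
      (lucasSeq X 1 (n + 1) = s ^ 2 ∧ lucasSeq X 1 n = X * t ^ 2) ∨
        (lucasSeq X 1 n = s ^ 2 ∧ lucasSeq X 1 (n + 1) = X * t ^ 2) := by
    have h2 := two_eq_zero_modTwo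
    induction n with
    | zero => exact ⟨1, 0, by simp [lucasSeq]⟩
    | succ n ih =>
      obtain ⟨s, t, ⟨h1, h0⟩ | ⟨h0, h1⟩⟩ := ih
      · refine ⟨s, s + t, Or.inr ⟨h1, ?_⟩⟩
        rw [lucasSeq, h1, h0]
        linear_combination -(X * s * t) * h2
      · refine ⟨X * t + s, t, Or.inl ⟨?_, h1⟩⟩
        rw [lucasSeq, h1, h0]
        linear_combination -(X * s * t) * h2
  obtain ⟨s, t, ⟨h1, h0⟩ | ⟨h0, h1⟩⟩ := h
  · rw [h1, h0, termCount_sq_add, termCount_sq, termCount_X_mul, termCount_sq]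
  · rw [h1, h0, add_comm (X * t ^ 2), termCount_sq_add, termCount_sq, termCount_X_mul,
      termCount_sq, add_comm]

theorem hasSpectralExponent_vCount :
    HasSpectralExponent vCount (vD0 + vD1) (Real.logb 2 3 - 1) ∧
      IsDominantEigenvalue (vD0 + vD1) ((3 : ℝ) : ℂ) := by
  refine hasSpectralExponent_of_recursion (A₀ := !![1, 0; 1, 1]) (A₁ := !![1, 1; 0, 1])
    (v := fun n => ![termCount (lucasSeq X 1 (n + 1)), termCount (lucasSeq X 1 n)])
    -- Positivity is tested at n = 1, because the second coordinate vanishes at n = 0. The vector of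
    -- ones works below since all column sums of the matrix are 3.
    (fun n => ?_) (fun n => ?_) (fun n => ?_) (fun i => ⟨1, ?_⟩) ?_ ?_
    (w := ![1, 1]) ?_ (by norm_num) ?_
  · rw [vCount, oddCount_eq_termCount, modTwo_fibPoly]; rfl
  · have h1 : termCount (lucasSeq X 1 (2 * n + 1)) =
        termCount (lucasSeq X 1 (n + 1)) + termCount (lucasSeq X 1 n) := by
      rw [← termCount_lucasSeq_X_one_add, ← termCount_sq (_ + _), lucasSeq_two_mul_add_one]
      congr 1
      linear_combination -(lucasSeq X 1 (n + 1) * lucasSeq X 1 n) * two_eq_zero_modTwo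
    have h0 : termCount (lucasSeq X 1 (2 * n)) = termCount (lucasSeq X 1 n) := by
      rw [lucasSeq_two_mul, termCount_X_mul, termCount_sq]
    ext i
    fin_cases i <;> simp [h1, h0, Matrix.vecMul, dotProduct, Fin.sum_univ_succ]
  · have h1 : termCount (lucasSeq X 1 (2 * n + 1)) =
        termCount (lucasSeq X 1 (n + 1)) + termCount (lucasSeq X 1 n) := by
      rw [← termCount_lucasSeq_X_one_add, ← termCount_sq (_ + _), lucasSeq_two_mul_add_one]
      congr 1
      linear_combination -(lucasSeq X 1 (n + 1) * lucasSeq X 1 n) * two_eq_zero_modTwo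
    have h0 : termCount (lucasSeq X 1 (2 * n + 1 + 1)) = termCount (lucasSeq X 1 (n + 1)) := by
      rw [show 2 * n + 1 + 1 = 2 * (n + 1) by ring, lucasSeq_two_mul, termCount_X_mul,
        termCount_sq]
    ext i
    fin_cases i <;> simp [h1, h0, Matrix.vecMul, dotProduct, Fin.sum_univ_succ]
  · fin_cases i
    · exact termCount_pos (by simp [lucasSeq])
    · exact termCount_pos (by simp [lucasSeq])
  · ext i j; fin_cases i <;> fin_cases j <;> simp [vD0]
  · ext i j; fin_cases i <;> fin_cases j <;> simp [vD1]
  · intro i; fin_cases i <;> simp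
  · ext i; fin_cases i <;> norm_num [Matrix.vecMul, dotProduct, Fin.sum_univ_succ]

/-- The state vector of Pascal's rhombus for consecutive rows `s`, `t`. -/
def rhombusState (s t : (ZMod 2)[X]) : Fin 5 → ℕ :=
  ![termCount t, termCount (t + X * s), termCount ((1 + X) * t), termCount ((1 + X) * s),
    termCount s]

/-- With s = U(n) and t = U(n+1), the left side is the state at 2n by the doubling formulas. The
identities `e0` to `e4` write each of its polynomials as a square or as e² + X·o², where e and o are
again among the five up to a factor X. -/
theorem rhombusState_even (s t : (ZMod 2)[X]) :
    rhombusState ((1 + X + X ^ 2) * s ^ 2) (t ^ 2 + X ^ 2 * s ^ 2) =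
      rhombusState s t ᵥ* !![0, 1, 0, 0, 0; 1, 0, 2, 0, 0; 0, 0, 0, 0, 0; 0, 1, 0, 0, 1;
        0, 0, 0, 2, 1] := by
  have h2 := two_eq_zero_modTwo
  have e0 : t ^ 2 + X ^ 2 * s ^ 2 = (t + X * s) ^ 2 := by
    linear_combination -(X * t * s) * h2
  have e1 : (t + X * s) ^ 2 + X * ((1 + X + X ^ 2) * s ^ 2) =
      t ^ 2 + X * ((1 + X) * s) ^ 2 := by
    linear_combination (X * t * s + X ^ 2 * s ^ 2 - X ^ 2 * s ^ 2) * h2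
  have e2 : (1 + X) * (t + X * s) ^ 2 = (t + X * s) ^ 2 + X * (t + X * s) ^ 2 := by ring
  have e3 : (1 + X) * ((1 + X + X ^ 2) * s ^ 2) = s ^ 2 + X * (X * s) ^ 2 := by
    linear_combination ((X + X ^ 2) * s ^ 2) * h2
  have e4 : (1 + X + X ^ 2) * s ^ 2 = ((1 + X) * s) ^ 2 + X * s ^ 2 := by
    linear_combination -(X * s ^ 2) * h2
  unfold rhombusState
  rw [e0, e1, e2, e3, e4]
  simp only [termCount_sq_add, termCount_sq, termCount_X_mul]
  ext i
  fin_cases i <;> simp [Matrix.vecMul, dotProduct, Fin.sum_univ_succ] <;> ring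

theorem rhombusState_odd (s t : (ZMod 2)[X]) :
    rhombusState (t ^ 2 + X ^ 2 * s ^ 2) ((1 + X + X ^ 2) * t ^ 2) =
      rhombusState s t ᵥ* !![1, 0, 2, 0, 0; 0, 0, 0, 2, 1; 1, 1, 0, 0, 0; 0, 0, 0, 0, 0;
        0, 1, 0, 0, 0] := by
  have h2 := two_eq_zero_modTwo
  have e0 : t ^ 2 + X ^ 2 * s ^ 2 = (t + X * s) ^ 2 := by
    linear_combination -(X * t * s) * h2
  have e1 : (1 + X + X ^ 2) * t ^ 2 + X * (t + X * s) ^ 2 =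
      ((1 + X) * t) ^ 2 + X * (X * s) ^ 2 := by
    linear_combination (X ^ 2 * t * s) * h2
  have e2 : (1 + X) * (t + X * s) ^ 2 = (t + X * s) ^ 2 + X * (t + X * s) ^ 2 := by ring
  have e3 : (1 + X) * ((1 + X + X ^ 2) * t ^ 2) = t ^ 2 + X * (X * t) ^ 2 := by
    linear_combination ((X + X ^ 2) * t ^ 2) * h2
  have e4 : (1 + X + X ^ 2) * t ^ 2 = ((1 + X) * t) ^ 2 + X * t ^ 2 := by
    linear_combination -(X * t ^ 2) * h2
  unfold rhombusState
  rw [e0, e1, e2, e3, e4]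
  simp only [termCount_sq_add, termCount_sq, termCount_X_mul]
  ext i
  fin_cases i <;> simp [Matrix.vecMul, dotProduct, Fin.sum_univ_succ] <;> ring

theorem hasSpectralExponent_uCount {lam : ℝ} (hlam : 1 < lam) (h : lam ^ 2 = 3 * lam + 2) :
    HasSpectralExponent uCount (uD0 + uD1) (Real.logb 2 lam - 1) ∧
      IsDominantEigenvalue (uD0 + uD1) (lam : ℂ) := by
  have h1X : (1 + X : (ZMod 2)[X]) ≠ 0 := fun h => by
    have := congrArg (coeff · 0) h
    simp at this
  refine hasSpectralExponent_of_recursion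
    (v := fun n => rhombusState (lucasSeq (1 + X + X ^ 2) (X ^ 2) n)
      (lucasSeq (1 + X + X ^ 2) (X ^ 2) (n + 1)))
    (fun n => ?_) (fun n => ?_) (fun n => ?_) (fun i => ?_)
    (A₀ := !![0, 1, 0, 0, 0; 1, 0, 2, 0, 0; 0, 0, 0, 0, 0; 0, 1, 0, 0, 1; 0, 0, 0, 2, 1])
    (A₁ := !![1, 0, 2, 0, 0; 0, 0, 0, 2, 1; 1, 1, 0, 0, 0; 0, 0, 0, 0, 0; 0, 1, 0, 0, 0])
    -- For this w every column of the eigenvector equation is an identity or the quadratic satisfied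
    -- by lam.
    ?_ ?_ (w := ![2, lam - 1, lam - 1, lam - 1, 2]) ?_ hlam ?_
  · rw [uCount, oddCount_eq_termCount, modTwo_rhombusPoly]; rfl
  · rw [lucasSeq_two_mul_add_one, lucasSeq_two_mul, rhombusState_even]
  · rw [show 2 * n + 1 + 1 = 2 * (n + 1) by ring, lucasSeq_two_mul_add_one, lucasSeq_two_mul,
      rhombusState_odd]
  · fin_cases i
    · exact ⟨0, termCount_pos (by simp [lucasSeq])⟩
    · exact ⟨0, termCount_pos (by simp [lucasSeq])⟩
    · exact ⟨0, termCount_pos (by simpa [lucasSeq] using h1X)⟩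
    · exact ⟨1, termCount_pos (by simpa [lucasSeq] using h1X)⟩
    · exact ⟨1, termCount_pos (by simp [lucasSeq])⟩
  · ext i j; fin_cases i <;> fin_cases j <;> simp [uD0]
  · ext i j; fin_cases i <;> fin_cases j <;> simp [uD1]
  · intro i; fin_cases i <;> simp [hlam]
  · ext i
    fin_cases i <;> simp [Matrix.vecMul, dotProduct, Fin.sum_univ_succ] <;> linarith

/-! ### The power families: states and eigenvectors -/

theorem modTwo_sum_range (r : ℕ) :
    modTwo (∑ i ∈ Finset.range r, X ^ i) = ofBits (List.replicate r true) := by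
  induction r with
  | zero => simp [ofBits]
  | succ r ih =>
    rw [Finset.sum_range_succ', List.replicate_succ, ofBits, ← ih]
    simp [modTwo, pow_succ', Finset.mul_sum, add_comm, Polynomial.map_sum]

/-- In each power family the states are the multipliers reached from 1 by taking halves of P and of
P·p; such halves have degree at most that of p once P does. Closure and multiplicities are finite
checks. -/
theorem hasSpectralExponent_f :
    HasSpectralExponent (gCount 1) (fD0 + fD1) (Real.logb 2 3 - 1) ∧
      IsDominantEigenvalue (fD0 + fD1) ((3 : ℝ) : ℂ) := by
  refine hasSpectralExponent_of_pow (m := 1) (fun _ => rfl) true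
    (List.replicate 2 true)
    ![[true]]
    (A₀ := !![1])
    (A₁ := !![2])
    (modTwo_sum_range _) (by decide) rfl (by decide) (by decide) (by decide) ?_ ?_
    (w := ![1]) ?_ (by norm_num) ?_
  · ext i j; fin_cases i; fin_cases j; simp [fD0]
  · ext i j; fin_cases i; fin_cases j; simp [fD1]
  · intro i; fin_cases i; simp
  · ext i
    fin_cases i; norm_num [Matrix.vecMul, dotProduct, Fin.sum_univ_succ]

theorem hasSpectralExponent_g {lam : ℝ} (hlow : 3 < lam) (hup : lam < 4)
    (h : lam ^ 2 = 2 * lam + 4) :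
    HasSpectralExponent (gCount 2) (gD0 + gD1) (Real.logb 2 lam - 1) ∧
      IsDominantEigenvalue (gD0 + gD1) ((lam : ℝ) : ℂ) := by
  refine hasSpectralExponent_of_pow (m := 2) (fun _ => rfl) true
    (List.replicate 3 true)
    ![[true], [true, true]]
    (A₀ := !![1, 2; 0, 0])
    (A₁ := !![1, 2; 1, 0])
    (modTwo_sum_range _) (by decide) rfl (by decide) (by decide) (by decide) ?_ ?_
    (w := ![lam, 4]) ?_ (by linarith) ?_
  · ext i j; fin_cases i <;> fin_cases j <;> simp [gD0]
  · ext i j; fin_cases i <;> fin_cases j <;> simp [gD1]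
  · intro i; fin_cases i
    · show 0 < lam; linarith
    · show (0 : ℝ) < 4; norm_num
  · ext i
    fin_cases i <;> simp [Matrix.vecMul, dotProduct, Fin.sum_univ_succ]; linarith

theorem hasSpectralExponent_g3 :
    HasSpectralExponent (gCount 3) (g3D0 + g3D1) (Real.logb 2 3 - 1) ∧
      IsDominantEigenvalue (g3D0 + g3D1) ((3 : ℝ) : ℂ) := by
  refine hasSpectralExponent_of_pow (m := 3) (fun _ => rfl) true
    (List.replicate 4 true)
    ![[true], [true, true], [true, false, true]]
    (A₀ := !![1, 2, 0; 0, 0, 1; 0, 0, 0])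
    (A₁ := !![0, 0, 0; 2, 0, 0; 0, 1, 2])
    (modTwo_sum_range _) (by decide) rfl (by decide) (by decide) (by decide) ?_ ?_
    (w := ![1, 1, 1]) ?_ (by norm_num) ?_
  · ext i j; fin_cases i <;> fin_cases j <;> simp [g3D0]
  · ext i j; fin_cases i <;> fin_cases j <;> simp [g3D1]
  · intro i; fin_cases i <;> simp
  · ext i
    fin_cases i <;> norm_num [Matrix.vecMul, dotProduct, Fin.sum_univ_succ]

theorem hasSpectralExponent_h3 {lam : ℝ} (hlow : 3.3 < lam) (hup : lam < 3.4)
    (h : lam ^ 4 - 3 * lam ^ 3 - 2 * lam ^ 2 + 2 * lam + 4 = 0) :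
    HasSpectralExponent (hCount 3) (h3D0 + h3D1) (Real.logb 2 lam - 1) ∧
      IsDominantEigenvalue (h3D0 + h3D1) ((lam : ℝ) : ℂ) := by
  -- The trinomial is not palindromic, so states are identified only up to powers of X.
  refine hasSpectralExponent_of_pow (m := 4) (fun _ => rfl) false
    [true, true, false, true]
    ![[true],
      [true, true],
      [true, true, true],
      [true, false, true]]
    (A₀ := !![1, 2, 1, 0; 0, 0, 1, 1; 0, 0, 0, 0; 0, 0, 0, 0])
    (A₁ := !![1, 1, 1, 0; 1, 0, 0, 1; 0, 1, 0, 0; 0, 0, 1, 1])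
    (by simp [ofBits, modTwo]; ring) (by decide) rfl (by decide) (by decide) (by decide) ?_ ?_
    -- With first entry 1, the first three columns determine the other entries in turn, and the last
    -- column is the quartic `h`.
    (w := ![1, lam - 2, lam ^ 2 - 2 * lam - 3, lam ^ 3 - 2 * lam ^ 2 - 4 * lam]) ?_ (by linarith) ?_
  · ext i j; fin_cases i <;> fin_cases j <;> simp [h3D0]
  · ext i j; fin_cases i <;> fin_cases j <;> simp [h3D1]
  · have h2 : 3.3 * lam < lam ^ 2 := by nlinarith
    have h3 : 3.3 * lam ^ 2 < lam ^ 3 := by nlinarith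
    intro i; fin_cases i <;> simp <;> nlinarith
  · ext i
    fin_cases i <;> simp [Matrix.vecMul, dotProduct, Fin.sum_univ_succ] <;> linarith

theorem hasSpectralExponent_g4 {lam : ℝ} (hlow : 3.4 < lam) (hup : lam < 3.5)
    (h : lam ^ 4 - lam ^ 3 - 6 * lam ^ 2 - 4 * lam - 16 = 0) :
    HasSpectralExponent (gCount 4) (g4D0 + g4D1) (Real.logb 2 lam - 1) ∧
      IsDominantEigenvalue (g4D0 + g4D1) ((lam : ℝ) : ℂ) := by
  refine hasSpectralExponent_of_pow (m := 4) (fun _ => rfl) true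
    (List.replicate 5 true)
    ![[true],
      [true, true, true],
      [true, true],
      [true, true, true, true]]
    (A₀ := !![1, 1, 2, 0; 0, 0, 0, 0; 0, 1, 0, 2; 0, 0, 0, 0])
    (A₁ := !![0, 1, 2, 0; 1, 0, 0, 0; 1, 0, 0, 2; 0, 1, 0, 0])
    (modTwo_sum_range _) (by decide) rfl (by decide) (by decide) (by decide) ?_ ?_
    (w := ![lam ^ 2, lam ^ 3 - lam ^ 2 - 4 * lam, 4 * lam, 16]) ?_ (by linarith) ?_
  · ext i j; fin_cases i <;> fin_cases j <;> simp [g4D0]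
  · ext i j; fin_cases i <;> fin_cases j <;> simp [g4D1]
  · have h2 : 3.4 * lam < lam ^ 2 := by nlinarith
    have h3 : 3.4 * lam ^ 2 < lam ^ 3 := by nlinarith
    intro i; fin_cases i <;> simp <;> nlinarith
  · ext i
    fin_cases i <;> simp [Matrix.vecMul, dotProduct, Fin.sum_univ_succ] <;> linarith

theorem hasSpectralExponent_h4 {lam : ℝ} (hlow : 3.3 < lam) (hup : lam < 3.4)
    (h : lam ^ 5 - 3 * lam ^ 4 - 2 * lam ^ 2 - 8 * lam + 8 = 0) :
    HasSpectralExponent (hCount 4) (h4D0 + h4D1) (Real.logb 2 lam - 1) ∧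
      IsDominantEigenvalue (h4D0 + h4D1) ((lam : ℝ) : ℂ) := by
  refine hasSpectralExponent_of_pow (m := 8) (fun _ => rfl) false
    [true, true, false, false, true]
    ![[true],
      [true, false, true],
      [true, true],
      [true, true, true, true],
      [true, true, true],
      [true, false, false, true],
      [true, false, true, true],
      [true, true, false, true]]
    (A₀ := !![1, 0, 2, 0, 1, 2, 1, 1;
      0, 0, 0, 0, 0, 0, 0, 0;
      0, 1, 0, 2, 1, 0, 1, 1;
      0, 0, 0, 0, 0, 0, 0, 0;
      0, 0, 0, 0, 0, 0, 0, 0;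
      0, 0, 0, 0, 0, 0, 0, 0;
      0, 0, 0, 0, 0, 0, 0, 0;
      0, 0, 0, 0, 0, 0, 0, 0])
    (A₁ := !![1, 0, 1, 0, 0, 1, 0, 0;
      1, 0, 0, 0, 0, 0, 0, 0;
      0, 1, 0, 1, 1, 0, 0, 1;
      0, 1, 0, 0, 0, 0, 0, 0;
      0, 0, 1, 0, 0, 0, 0, 1;
      0, 0, 0, 1, 0, 0, 1, 0;
      0, 0, 0, 0, 1, 0, 0, 0;
      0, 0, 0, 0, 0, 1, 1, 0])
    (by simp [ofBits, modTwo]; ring) (by decide) rfl (by decide) (by decide) (by decide) ?_ ?_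
    -- The eigenvector is taken with equal entries at indices 2, 5 and at 4, 6, 7. Five distinct
    -- column equations remain, and their compatibility is the quintic `h`.
    (w := ![2 * lam + 4,
      (lam - 2) * (2 * lam + 4),
      lam ^ 2 * (lam - 2),
      4 * lam * (lam - 2),
      lam ^ 4 - 2 * lam ^ 3 - 6 * lam - 12,
      lam ^ 2 * (lam - 2),
      lam ^ 4 - 2 * lam ^ 3 - 6 * lam - 12,
      lam ^ 4 - 2 * lam ^ 3 - 6 * lam - 12]) ?_ (by linarith) ?_
  · ext i j; fin_cases i <;> fin_cases j <;> simp [h4D0]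
  · ext i j; fin_cases i <;> fin_cases j <;> simp [h4D1]
  · have h2 : 0 < lam - 2 := by linarith
    have h4 : 0 < lam ^ 4 - 2 * lam ^ 3 - 6 * lam - 12 := by
      -- Column 4 of the eigenvector equation reads (λ − 1)w₄ = 2w₂ + w₀, with positive right side.
      refine pos_of_mul_pos_right (a := lam - 1) ?_ (by linarith)
      rw [show (lam - 1) * (lam ^ 4 - 2 * lam ^ 3 - 6 * lam - 12) =
        2 * (lam ^ 2 * (lam - 2)) + (2 * lam + 4) by linear_combination h]
      positivity
    intro i; fin_cases i
    · show 0 < 2 * lam + 4; positivity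
    · show 0 < (lam - 2) * (2 * lam + 4); positivity
    · show 0 < lam ^ 2 * (lam - 2); positivity
    · show 0 < 4 * lam * (lam - 2); positivity
    · exact h4
    · show 0 < lam ^ 2 * (lam - 2); positivity
    · exact h4
    · exact h4
  · ext i
    fin_cases i <;> simp [Matrix.vecMul, dotProduct, Fin.sum_univ_succ] <;> linarith

theorem hasSpectralExponent_g5 {lam : ℝ} (hlow : 3.52 < lam) (hup : lam < 3.53)
    (h : lam ^ 6 - 4 * lam ^ 5 + lam ^ 4 - lam ^ 3 + 8 * lam ^ 2 + 11 * lam + 8 = 0) :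
    HasSpectralExponent (gCount 5) (g5D0 + g5D1) (Real.logb 2 lam - 1) ∧
      IsDominantEigenvalue (g5D0 + g5D1) ((lam : ℝ) : ℂ) := by
  refine hasSpectralExponent_of_pow (m := 6) (fun _ => rfl) true
    (List.replicate 6 true)
    ![[true],
      [true, true, true],
      [true, true],
      [true, false, false, true],
      [true, true, false, true, true],
      [true, false, true]]
    (A₀ := !![1, 1, 2, 2, 0, 0;
      0, 0, 0, 0, 0, 0;
      0, 1, 0, 0, 1, 1;
      0, 0, 0, 0, 0, 0;
      0, 0, 0, 0, 0, 0;
      0, 0, 0, 0, 1, 0])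
    (A₁ := !![0, 0, 0, 0, 0, 0;
      2, 2, 0, 0, 0, 0;
      0, 0, 0, 0, 0, 0;
      0, 0, 1, 1, 2, 2;
      0, 0, 0, 1, 0, 0;
      0, 0, 0, 0, 0, 0])
    (modTwo_sum_range _) (by decide) rfl (by decide) (by decide) (by decide) ?_ ?_
    (w := ![2,
      lam - 1,
      lam ^ 2 - 3 * lam,
      lam ^ 3 - 3 * lam ^ 2 - 4,
      lam ^ 4 - 4 * lam ^ 3 + 3 * lam ^ 2 - 4 * lam,
      lam ^ 5 - 4 * lam ^ 4 + lam ^ 3 + lam ^ 2 + 3 * lam + 8]) ?_ (by linarith) ?_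
  · ext i j; fin_cases i <;> fin_cases j <;> simp [g5D0]
  · ext i j; fin_cases i <;> fin_cases j <;> simp [g5D1]
  · have h2 : 1.75 < lam ^ 2 - 3 * lam := by nlinarith
    have h3 : 2 < lam ^ 3 - 3 * lam ^ 2 - 4 := by nlinarith
    have h4 : 0 < lam ^ 4 - 4 * lam ^ 3 + 3 * lam ^ 2 - 4 * lam := by nlinarith
    have h5 : 0 < lam ^ 5 - 4 * lam ^ 4 + lam ^ 3 + lam ^ 2 + 3 * lam + 8 := by
      -- By `h`, λw₅ = w₂ + 2w₃, which is the last column of the eigenvector equation.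
      refine pos_of_mul_pos_right (a := lam) ?_ (by linarith)
      linarith
    intro i; fin_cases i
    · exact two_pos
    · show 0 < lam - 1; linarith
    · show 0 < lam ^ 2 - 3 * lam; linarith
    · show 0 < lam ^ 3 - 3 * lam ^ 2 - 4; linarith
    · exact h4
    · exact h5
  · ext i
    fin_cases i <;> simp [Matrix.vecMul, dotProduct, Fin.sum_univ_succ] <;> linarith

theorem hasSpectralExponent_g6 {lam : ℝ} (hlow : 3.55 < lam) (hup : lam < 3.56)
    (h : lam ^ 6 - lam ^ 5 - 2 * lam ^ 4 - 28 * lam ^ 3 + 16 * lam + 64 = 0) :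
    HasSpectralExponent (gCount 6) (g6D0 + g6D1) (Real.logb 2 lam - 1) ∧
      IsDominantEigenvalue (g6D0 + g6D1) ((lam : ℝ) : ℂ) := by
  refine hasSpectralExponent_of_pow (m := 6) (fun _ => rfl) true
    (List.replicate 7 true)
    ![[true],
      [true, true, true, true],
      [true, true, true],
      [true, true],
      [true, true, true, true, true],
      [true, true, true, true, true, true]]
    (A₀ := !![1, 0, 1, 2, 0, 0;
      0, 0, 0, 0, 0, 0;
      0, 0, 0, 0, 1, 2;
      0, 2, 1, 0, 1, 0;
      0, 0, 0, 0, 0, 0;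
      0, 0, 0, 0, 0, 0])
    (A₁ := !![0, 0, 0, 2, 1, 0;
      1, 0, 0, 0, 0, 0;
      1, 0, 0, 0, 0, 2;
      0, 2, 1, 0, 0, 0;
      0, 0, 1, 0, 0, 0;
      0, 0, 0, 0, 1, 0])
    (modTwo_sum_range _) (by decide) rfl (by decide) (by decide) (by decide) ?_ ?_
    (w := ![lam ^ 2,
      16,
      lam ^ 3 - lam ^ 2 - 16,
      4 * lam,
      lam ^ 4 - lam ^ 3 - lam ^ 2 - 24 * lam,
      lam ^ 5 - lam ^ 4 - 2 * lam ^ 3 - 24 * lam ^ 2 - 4 * lam + 16]) ?_ (by linarith) ?_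
  · ext i j; fin_cases i <;> fin_cases j <;> simp [g6D0]
  · ext i j; fin_cases i <;> fin_cases j <;> simp [g6D1]
  · have h0 : 3.5 * lam < lam ^ 2 := by nlinarith
    have h1 : 3.5 * lam ^ 2 < lam ^ 3 := by nlinarith
    have h2 : 0 < lam ^ 3 - lam ^ 2 - 16 := by nlinarith
    have h4 : 0 < lam ^ 4 - lam ^ 3 - lam ^ 2 - 24 * lam := by nlinarith
    have h5 : 0 < lam ^ 5 - lam ^ 4 - 2 * lam ^ 3 - 24 * lam ^ 2 - 4 * lam + 16 := by
      -- By `h`, λw₅ = 4w₂, which is the last column of the eigenvector equation.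
      refine pos_of_mul_pos_right (a := lam) ?_ (by linarith)
      linarith
    intro i; fin_cases i
    · show 0 < lam ^ 2; positivity
    · show (0 : ℝ) < 16; norm_num
    · exact h2
    · show 0 < 4 * lam; linarith
    · exact h4
    · exact h5
  · ext i
    fin_cases i <;> simp [Matrix.vecMul, dotProduct, Fin.sum_univ_succ] <;> linarith

/-! ### Irreducibility and minimal polynomials of the eigenvalues -/

/-- A monic quartic is irreducible if it has no linear factor modulo `p` and no quadratic factor
modulo `q`. -/
theorem irreducible_quartic (p q : ℕ) (c₃ c₂ c₁ c₀ : ℤ)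
    (h₁ : ∀ a : ZMod p, a ^ 4 + c₃ * a ^ 3 + c₂ * a ^ 2 + c₁ * a + c₀ ≠ 0)
    (h₂ : ∀ a b : ZMod q,
      let x := c₃ - a
      let y := c₂ - b - a * x
      ¬ (c₁ = a * y + b * x ∧ c₀ = b * y)) :
    Irreducible (X ^ 4 + C c₃ * X ^ 3 + C c₂ * X ^ 2 + C c₁ * X + C c₀ : ℤ[X]) := by
  set P : ℤ[X] := X ^ 4 + C c₃ * X ^ 3 + C c₂ * X ^ 2 + C c₁ * X + C c₀ with hP
  have hdeg : P.natDegree = 4 := by rw [hP]; compute_degree!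
  have hmon : P.Monic := by rw [hP]; monicity!
  have hne : P ≠ 1 := fun h => by rw [h] at hdeg; simp at hdeg
  -- A proper monic factorization has a factor of degree at most half, here 1 or 2, and it survives
  -- reduction modulo p and q.
  rw [hmon.irreducible_iff_lt_natDegree_lt hne, hdeg]
  rintro f hf hd ⟨g, hg⟩
  have hgm : g.Monic := hf.of_mul_monic_left (hg ▸ hmon)
  have hsum : f.natDegree + g.natDegree = 4 := by rw [← hf.natDegree_mul hgm, ← hg, hdeg]
  have hfc := hf.coeff_natDegree
  have hgc := hgm.coeff_natDegree
  have hfz : ∀ n, f.natDegree < n → f.coeff n = 0 := fun n => coeff_eq_zero_of_natDegree_lt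
  have hgz : ∀ n, g.natDegree < n → g.coeff n = 0 := fun n => coeff_eq_zero_of_natDegree_lt
  have hk : ∀ k, ((P.coeff k : ℤ) : ZMod q) = ((f * g).coeff k : ℤ) := fun k => by rw [hg]
  have k0 := hk 0
  have k1 := hk 1
  have k2 := hk 2
  have k3 := hk 3
  obtain hd | hd : f.natDegree = 1 ∨ f.natDegree = 2 := by
    simp at hd; omega
  · rw [hd] at hfc
    have hroot : f.eval (-f.coeff 0) = 0 := by
      rw [eval_eq_sum_range, hd]
      simp [Finset.sum_range_succ, hfc]
    have h := congrArg (eval (-f.coeff 0)) hg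
    rw [eval_mul, hroot, zero_mul] at h
    apply h₁ (-f.coeff 0 : ℤ)
    simpa [hP] using congrArg (Int.cast : ℤ → ZMod p) h
  · obtain he : g.natDegree = 2 := by omega
    rw [hd] at hfc hfz
    rw [he] at hgc hgz
    simp [hP, coeff_mul, Finset.Nat.antidiagonal_succ, coeff_X, coeff_C, -eq_intCast, hfc, hgc, hfz,
      hgz]
      at k0 k1 k2 k3
    have h := h₂ (f.coeff 1 : ℤ) (f.coeff 0 : ℤ)
    -- The top coefficients force the cofactor, so x and y of `h₂` are its coefficients; the two
    -- lowest coefficients then contradict `h₂`.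
    have e3 : (c₃ - f.coeff 1 : ZMod q) = g.coeff 1 := by rw [k3]; ring
    have e2 : (c₂ - f.coeff 0 - f.coeff 1 * g.coeff 1 : ZMod q) = g.coeff 0 := by rw [k2]; ring
    simp only [e3, e2] at h
    exact h ⟨by rw [k1]; ring, k0⟩

/-- A monic sextic is irreducible if it has no factor of degree at most three modulo `p`. -/
theorem irreducible_sextic (p : ℕ) (c₅ c₄ c₃ c₂ c₁ c₀ : ℤ)
    (h₁ : ∀ a : ZMod p,
      a ^ 6 + c₅ * a ^ 5 + c₄ * a ^ 4 + c₃ * a ^ 3 + c₂ * a ^ 2 + c₁ * a + c₀ ≠ 0)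
    (h₂ : ∀ a b : ZMod p,
      let x := c₅ - a
      let y := c₄ - b - a * x
      let z := c₃ - a * y - b * x
      let t := c₂ - a * z - b * y
      ¬ (c₁ = a * t + b * z ∧ c₀ = b * t))
    (h₃ : ∀ a b c : ZMod p,
      let x := c₅ - a
      let y := c₄ - b - a * x
      let z := c₃ - c - a * y - b * x
      ¬ (c₂ = a * z + b * y + c * x ∧ c₁ = b * z + c * y ∧ c₀ = c * z)) :
    Irreducible (X ^ 6 + C c₅ * X ^ 5 + C c₄ * X ^ 4 + C c₃ * X ^ 3 + C c₂ * X ^ 2 + C c₁ * X +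
      C c₀ : ℤ[X]) := by
  set P : ℤ[X] := X ^ 6 + C c₅ * X ^ 5 + C c₄ * X ^ 4 + C c₃ * X ^ 3 + C c₂ * X ^ 2 + C c₁ * X +
    C c₀ with hP
  have hdeg : P.natDegree = 6 := by rw [hP]; compute_degree!
  have hmon : P.Monic := by rw [hP]; monicity!
  have hne : P ≠ 1 := fun h => by rw [h] at hdeg; simp at hdeg
  rw [hmon.irreducible_iff_lt_natDegree_lt hne, hdeg]
  rintro f hf hd ⟨g, hg⟩
  have hgm : g.Monic := hf.of_mul_monic_left (hg ▸ hmon)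
  have hsum : f.natDegree + g.natDegree = 6 := by rw [← hf.natDegree_mul hgm, ← hg, hdeg]
  have hfc := hf.coeff_natDegree
  have hgc := hgm.coeff_natDegree
  have hfz : ∀ n, f.natDegree < n → f.coeff n = 0 := fun n => coeff_eq_zero_of_natDegree_lt
  have hgz : ∀ n, g.natDegree < n → g.coeff n = 0 := fun n => coeff_eq_zero_of_natDegree_lt
  have hk : ∀ k, ((P.coeff k : ℤ) : ZMod p) = ((f * g).coeff k : ℤ) := fun k => by rw [hg]
  have k0 := hk 0
  have k1 := hk 1
  have k2 := hk 2
  have k3 := hk 3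
  have k4 := hk 4
  have k5 := hk 5
  obtain hd | hd | hd : f.natDegree = 1 ∨ f.natDegree = 2 ∨ f.natDegree = 3 := by
    simp at hd; omega
  · rw [hd] at hfc
    have hroot : f.eval (-f.coeff 0) = 0 := by
      rw [eval_eq_sum_range, hd]
      simp [Finset.sum_range_succ, hfc]
    have h := congrArg (eval (-f.coeff 0)) hg
    rw [eval_mul, hroot, zero_mul] at h
    apply h₁ (-f.coeff 0 : ℤ)
    simpa [hP] using congrArg (Int.cast : ℤ → ZMod p) h
  · obtain he : g.natDegree = 4 := by omega
    rw [hd] at hfc hfz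
    rw [he] at hgc hgz
    simp [hP, coeff_mul, Finset.Nat.antidiagonal_succ, coeff_X, coeff_C, -eq_intCast, hfc, hgc, hfz,
      hgz]
      at k0 k1 k2 k3 k4 k5
    have h := h₂ (f.coeff 1 : ℤ) (f.coeff 0 : ℤ)
    have e5 : (c₅ - f.coeff 1 : ZMod p) = g.coeff 3 := by rw [k5]; ring
    have e4 : (c₄ - f.coeff 0 - f.coeff 1 * g.coeff 3 : ZMod p) = g.coeff 2 := by rw [k4]; ring
    have e3 : (c₃ - f.coeff 1 * g.coeff 2 - f.coeff 0 * g.coeff 3 : ZMod p) = g.coeff 1 := by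
      rw [k3]; ring
    have e2 : (c₂ - f.coeff 1 * g.coeff 1 - f.coeff 0 * g.coeff 2 : ZMod p) = g.coeff 0 := by
      rw [k2]; ring
    simp only [e5, e4, e3, e2] at h
    exact h ⟨by rw [k1]; ring, k0⟩
  · obtain he : g.natDegree = 3 := by omega
    rw [hd] at hfc hfz
    rw [he] at hgc hgz
    simp [hP, coeff_mul, Finset.Nat.antidiagonal_succ, coeff_X, coeff_C, -eq_intCast, hfc, hgc, hfz,
      hgz]
      at k0 k1 k2 k3 k4 k5
    have h := h₃ (f.coeff 2 : ℤ) (f.coeff 1 : ℤ) (f.coeff 0 : ℤ)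
    have e5 : (c₅ - f.coeff 2 : ZMod p) = g.coeff 2 := by rw [k5]; ring
    have e4 : (c₄ - f.coeff 1 - f.coeff 2 * g.coeff 2 : ZMod p) = g.coeff 1 := by rw [k4]; ring
    have e3 : (c₃ - f.coeff 0 - f.coeff 2 * g.coeff 1 - f.coeff 1 * g.coeff 2 : ZMod p) =
        g.coeff 0 := by
      rw [k3]; ring
    simp only [e5, e4, e3] at h
    exact h ⟨by rw [k2]; ring, by rw [k1]; ring, k0⟩

/-- The minimal polynomial of an eigenvalue of an integer matrix annihilated by an irreducible monic
integer polynomial. -/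
theorem minpoly_eq_of_isEigenvalue {m : ℕ} {P : ℤ[X]} (hirr : Irreducible P) (hmon : P.Monic)
    {A : Matrix (Fin m) (Fin m) ℤ} (hA : aeval A P = 0) {M : Matrix (Fin m) (Fin m) ℂ}
    (hM : M = A.map (Int.castRingHom ℂ)) {μ : ℂ} (hμ : IsEigenvalue M μ) :
    minpoly ℚ μ = P.map (Int.castRingHom ℚ) := by
  have hroot : aeval μ P = 0 := by
    obtain ⟨x, hx⟩ := hμ.exists_hasEigenvector
    -- The annihilation passes from the integer matrix to M; applied to an eigenvector it gives
    -- P(μ)x = 0.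
    have h0 : aeval M (P.map (Int.castRingHom ℂ)) = 0 := by
      rw [hM, ← map_zero ((Int.castRingHom ℂ).mapMatrix (m := Fin m)), ← hA]
      exact (Polynomial.map_aeval_eq_aeval_map (φ := Int.castRingHom ℂ)
        (ψ := (Int.castRingHom ℂ).mapMatrix (m := Fin m)) (by ext; simp) P A).symm
    have h1 : aeval (Matrix.toLin' M) (P.map (Int.castRingHom ℂ)) = 0 := by
      have := congrArg (Matrix.toLinAlgEquiv' (R := ℂ)) h0
      rwa [map_zero, ← Polynomial.aeval_algHom_apply] at this
    have h2 := Module.End.aeval_apply_of_hasEigenvector (p := P.map (Int.castRingHom ℂ)) hx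
    rw [h1, LinearMap.zero_apply, eq_comm, smul_eq_zero] at h2
    rw [← h2.resolve_right hx.2, eval_map]
    rfl
  -- Gauss's lemma makes the monic P irreducible over ℚ as well.
  refine (minpoly.eq_of_irreducible_of_monic
    (hmon.irreducible_iff_irreducible_map_fraction_map.1 hirr) ?_ (hmon.map _)).symm
  rw [aeval_map_algebraMap, hroot]

theorem minpoly_h3 {μ : ℂ} (hμ : IsEigenvalue (h3D0 + h3D1) μ) :
    minpoly ℚ μ = X ^ 4 - 3 * X ^ 3 - 2 * X ^ 2 + 2 * X + 4 := by
  rw [minpoly_eq_of_isEigenvalue (irreducible_quartic 3 3 (-3) (-2) 2 4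
    (by decide) (by decide))
    (by monicity!)
    (A := !![2, 3, 2, 0; 1, 0, 1, 2; 0, 1, 0, 0; 0, 0, 1, 1]) ?_ ?_ hμ]
  · simp; ring
  · simp only [map_add, map_mul, map_pow, aeval_X, aeval_C]; decide +kernel
  · ext i j; fin_cases i <;> fin_cases j <;> norm_num [h3D0, h3D1]

theorem minpoly_g4 {μ : ℂ} (hμ : IsEigenvalue (g4D0 + g4D1) μ) :
    minpoly ℚ μ = X ^ 4 - X ^ 3 - 6 * X ^ 2 - 4 * X - 16 := by
  -- Neither modulus suffices alone: modulo 3 the quartic is (X² + 1)(X² − X − 1), and modulo 5 it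
  -- has the root 2.
  rw [minpoly_eq_of_isEigenvalue (irreducible_quartic 3 5 (-1) (-6) (-4) (-16)
    (by decide) (by decide))
    (by monicity!)
    (A := !![1, 2, 4, 0; 1, 0, 0, 0; 1, 1, 0, 4; 0, 1, 0, 0]) ?_ ?_ hμ]
  · simp; ring
  · simp only [map_add, map_mul, map_pow, aeval_X, aeval_C]; decide +kernel
  · ext i j; fin_cases i <;> fin_cases j <;> norm_num [g4D0, g4D1]

theorem minpoly_g5 {μ : ℂ} (hμ : IsEigenvalue (g5D0 + g5D1) μ) :
    minpoly ℚ μ = X ^ 6 - 4 * X ^ 5 + X ^ 4 - X ^ 3 + 8 * X ^ 2 + 11 * X + 8 := by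
  rw [minpoly_eq_of_isEigenvalue (irreducible_sextic 5 (-4) 1 (-1) 8 11 8
    (by decide +kernel) (by decide +kernel) (by decide +kernel))
    (by monicity!)
    (A := !![1, 1, 2, 2, 0, 0;
      2, 2, 0, 0, 0, 0;
      0, 1, 0, 0, 1, 1;
      0, 0, 1, 1, 2, 2;
      0, 0, 0, 1, 0, 0;
      0, 0, 0, 0, 1, 0]) ?_ ?_ hμ]
  · simp; ring
  · simp only [map_add, map_mul, map_pow, aeval_X, aeval_C]; decide +kernel
  · ext i j; fin_cases i <;> fin_cases j <;> norm_num [g5D0, g5D1]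

theorem minpoly_g6 {μ : ℂ} (hμ : IsEigenvalue (g6D0 + g6D1) μ) :
    minpoly ℚ μ = X ^ 6 - X ^ 5 - 2 * X ^ 4 - 28 * X ^ 3 + 16 * X + 64 := by
  rw [minpoly_eq_of_isEigenvalue (irreducible_sextic 3 (-1) (-2) (-28) 0 16 64
    (by decide +kernel) (by decide +kernel) (by decide +kernel))
    (by monicity!)
    (A := !![1, 0, 1, 4, 1, 0;
      1, 0, 0, 0, 0, 0;
      1, 0, 0, 0, 1, 4;
      0, 4, 2, 0, 1, 0;
      0, 0, 1, 0, 0, 0;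
      0, 0, 0, 0, 1, 0]) ?_ ?_ hμ]
  · simp; ring
  · simp only [map_add, map_mul, map_pow, aeval_X, aeval_C]; decide +kernel
  · ext i j; fin_cases i <;> fin_cases j <;> norm_num [g6D0, g6D1]

/-! ### Rational enclosures of roots and logarithms -/

theorem exists_root_mem_Icc {f : ℝ → ℝ} (hf : Continuous f) {l u : ℝ} (hlu : l ≤ u)
    (hl : f l ≤ 0) (hu : 0 ≤ f u) : ∃ x, l ≤ x ∧ x ≤ u ∧ f x = 0 := by
  obtain ⟨x, hx, h⟩ := intermediate_value_Icc hlu hf.continuousOn ⟨hl, hu⟩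
  exact ⟨x, hx.1, hx.2, h⟩

/-- The number log 2 is 2 artanh(1/3), and the error after n terms of the series is of order 9^(−n).
-/
theorem log_two_lower : 0.693147180559945309417232121458 ≤ Real.log 2 := by
  have h := Real.sum_range_le_log_div (x := 1 / 3) (by norm_num) (by norm_num) 31
  rw [show ((1 + 1 / 3) / (1 - 1 / 3) : ℝ) = 2 by norm_num] at h
  have h' : (0.693147180559945309417232121458 : ℝ) / 2 ≤
      ∑ i ∈ Finset.range 31, (1 / 3 : ℝ) ^ (2 * i + 1) / (2 * i + 1) := by
    norm_num [Finset.sum_range_succ]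
  linarith

theorem log_two_upper : Real.log 2 ≤ 0.693147180559945309417232121459 := by
  have h := Real.log_div_le_sum_range_add (x := 1 / 3) (by norm_num) (by norm_num) 32
  rw [show ((1 + 1 / 3) / (1 - 1 / 3) : ℝ) = 2 by norm_num] at h
  have h' : ∑ i ∈ Finset.range 32, (1 / 3 : ℝ) ^ (2 * i + 1) / (2 * i + 1) +
      (1 / 3) ^ (2 * 32 + 1) / (1 - (1 / 3) ^ 2) ≤ (0.693147180559945309417232121459 : ℝ) / 2 := by
    norm_num [Finset.sum_range_succ]
  linarith

/-- A rational lower bound for `log₂ lam - 1` from the series of the inverse hyperbolic tangent. -/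
theorem le_logb_sub_one {lam a x : ℝ} (n : ℕ) (hx₀ : 0 ≤ x) (hx₁ : x < 1)
    (hlam : 2 * ((1 + x) / (1 - x)) ≤ lam) (ha : 0 ≤ a)
    (h : a * 0.693147180559945309417232121459 ≤
      2 * ∑ i ∈ Finset.range n, x ^ (2 * i + 1) / (2 * i + 1)) :
    a ≤ Real.logb 2 lam - 1 := by
  have h1 := Real.sum_range_le_log_div hx₀ hx₁ n
  have hq : 0 < (1 + x) / (1 - x) := div_pos (by linarith) (by linarith)
  have h2 := Real.log_le_log (by positivity) hlam
  rw [Real.log_mul two_ne_zero hq.ne'] at h2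
  have h3 := mul_le_mul_of_nonneg_left log_two_upper ha
  have h4 : 0 < Real.log 2 := Real.log_pos one_lt_two
  rw [le_sub_iff_add_le, Real.logb, le_div_iff₀ h4]
  linarith

/-- A rational upper bound for `log₂ lam - 1` from the series of the inverse hyperbolic tangent. -/
theorem logb_sub_one_lt {lam a x : ℝ} (n : ℕ) (hx₀ : 0 ≤ x) (hx₁ : x < 1) (hpos : 0 < lam)
    (hlam : lam ≤ 2 * ((1 + x) / (1 - x))) (ha : 0 ≤ a)
    (h : 2 * (∑ i ∈ Finset.range n, x ^ (2 * i + 1) / (2 * i + 1) +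
      x ^ (2 * n + 1) / (1 - x ^ 2)) < a * 0.693147180559945309417232121458) :
    Real.logb 2 lam - 1 < a := by
  have h1 := Real.log_div_le_sum_range_add hx₀ hx₁ n
  have hq : 0 < (1 + x) / (1 - x) := div_pos (by linarith) (by linarith)
  have h2 := Real.log_le_log hpos hlam
  rw [Real.log_mul two_ne_zero hq.ne'] at h2
  have h3 := mul_le_mul_of_nonneg_left log_two_lower ha
  have h4 : 0 < Real.log 2 := Real.log_pos one_lt_two
  rw [sub_lt_iff_lt_add, Real.logb, div_lt_iff₀ h4]
  linarith

/-- A sign change on an interval of length 10^(−30) leaves room for 25 certified digits of the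
logarithm. That this root is the dominant one follows from positivity of w. -/
theorem exists_root_h3 : ∃ lam : ℝ, 3.311422085047488676153533362074 ≤ lam ∧
    lam ≤ 3.311422085047488676153533362075 ∧
    lam ^ 4 - 3 * lam ^ 3 - 2 * lam ^ 2 + 2 * lam + 4 = 0 :=
  exists_root_mem_Icc (f := fun lam => lam ^ 4 - 3 * lam ^ 3 - 2 * lam ^ 2 + 2 * lam + 4)
    (by fun_prop) (by norm_num) (by norm_num) (by norm_num)

theorem logb_bounds_h3 {lam : ℝ} (hl : 3.311422085047488676153533362074 ≤ lam)
    (hu : lam ≤ 3.311422085047488676153533362075) :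
    0.7274509132400228143266172 ≤ Real.logb 2 lam - 1 ∧
      Real.logb 2 lam - 1 < 0.7274509132400228143266173 := by
  constructor
  -- Here x approximates (λ − 2)/(λ + 2) from below, since λ/2 = (1 + x)/(1 − x) at equality; the
  -- upper bound rounds it up. The other families do the same.
  · refine le_logb_sub_one (x := 0.246906019527115671913664564547) 26 (by norm_num) (by norm_num)
      (le_trans (by norm_num) hl) (by norm_num) ?_
    norm_num [Finset.sum_range_succ]
  · refine logb_sub_one_lt (x := 0.246906019527115671913664564549) 26 (by norm_num) (by norm_num)
      (by linarith) (hu.trans (by norm_num)) (by norm_num) ?_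
    norm_num [Finset.sum_range_succ]

theorem exists_root_g4 : ∃ lam : ℝ, 3.457290545292196495878562286351 ≤ lam ∧
    lam ≤ 3.457290545292196495878562286352 ∧
    lam ^ 4 - lam ^ 3 - 6 * lam ^ 2 - 4 * lam - 16 = 0 :=
  exists_root_mem_Icc (f := fun lam => lam ^ 4 - lam ^ 3 - 6 * lam ^ 2 - 4 * lam - 16)
    (by fun_prop) (by norm_num) (by norm_num) (by norm_num)

theorem logb_bounds_g4 {lam : ℝ} (hl : 3.457290545292196495878562286351 ≤ lam)
    (hu : lam ≤ 3.457290545292196495878562286352) :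
    0.7896418505307685639015472 ≤ Real.logb 2 lam - 1 ∧
      Real.logb 2 lam - 1 < 0.7896418505307685639015473 := by
  constructor
  · refine le_logb_sub_one (x := 0.267035543223797633789633654144) 26 (by norm_num) (by norm_num)
      (le_trans (by norm_num) hl) (by norm_num) ?_
    norm_num [Finset.sum_range_succ]
  · refine logb_sub_one_lt (x := 0.267035543223797633789633654145) 26 (by norm_num) (by norm_num)
      (by linarith) (hu.trans (by norm_num)) (by norm_num) ?_
    norm_num [Finset.sum_range_succ]

theorem exists_root_h4 : ∃ lam : ℝ, 3.33159158 ≤ lam ∧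
    lam ≤ 3.33159159 ∧
    lam ^ 5 - 3 * lam ^ 4 - 2 * lam ^ 2 - 8 * lam + 8 = 0 :=
  exists_root_mem_Icc (f := fun lam => lam ^ 5 - 3 * lam ^ 4 - 2 * lam ^ 2 - 8 * lam + 8)
    (by fun_prop) (by norm_num) (by norm_num) (by norm_num)

theorem logb_bounds_h4 {lam : ℝ} (hl : 3.33159158 ≤ lam)
    (hu : lam ≤ 3.33159159) :
    0.736 ≤ Real.logb 2 lam - 1 ∧
      Real.logb 2 lam - 1 < 0.737 := by
  constructor
  · refine le_logb_sub_one (x := 0.24975498) 8 (by norm_num) (by norm_num)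
      (le_trans (by norm_num) hl) (by norm_num) ?_
    norm_num [Finset.sum_range_succ]
  · refine logb_sub_one_lt (x := 0.24975499) 8 (by norm_num) (by norm_num)
      (by linarith) (hu.trans (by norm_num)) (by norm_num) ?_
    norm_num [Finset.sum_range_succ]

theorem exists_root_g5 : ∃ lam : ℝ, 3.529513800236356108652380273521 ≤ lam ∧
    lam ≤ 3.529513800236356108652380273522 ∧
    lam ^ 6 - 4 * lam ^ 5 + lam ^ 4 - lam ^ 3 + 8 * lam ^ 2 + 11 * lam + 8 = 0 :=
  exists_root_mem_Icc (f := fun lam => lam ^ 6 - 4 * lam ^ 5 + lam ^ 4 - lam ^ 3 + 8 * lam ^ 2 + 11 * lam + 8)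
    (by fun_prop) (by norm_num) (by norm_num) (by norm_num)

theorem logb_bounds_g5 {lam : ℝ} (hl : 3.529513800236356108652380273521 ≤ lam)
    (hu : lam ≤ 3.529513800236356108652380273522) :
    0.8194694621655401465959376 ≤ Real.logb 2 lam - 1 ∧
      Real.logb 2 lam - 1 < 0.8194694621655401465959377 := by
  constructor
  · refine le_logb_sub_one (x := 0.276609093582690373188925486471) 26 (by norm_num) (by norm_num)
      (le_trans (by norm_num) hl) (by norm_num) ?_
    norm_num [Finset.sum_range_succ]
  · refine logb_sub_one_lt (x := 0.276609093582690373188925486472) 26 (by norm_num) (by norm_num)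
      (by linarith) (hu.trans (by norm_num)) (by norm_num) ?_
    norm_num [Finset.sum_range_succ]

theorem exists_root_g6 : ∃ lam : ℝ, 3.559800513486339340129810096526 ≤ lam ∧
    lam ≤ 3.559800513486339340129810096527 ∧
    lam ^ 6 - lam ^ 5 - 2 * lam ^ 4 - 28 * lam ^ 3 + 16 * lam + 64 = 0 :=
  exists_root_mem_Icc (f := fun lam => lam ^ 6 - lam ^ 5 - 2 * lam ^ 4 - 28 * lam ^ 3 + 16 * lam + 64)
    (by fun_prop) (by norm_num) (by norm_num) (by norm_num)

theorem logb_bounds_g6 {lam : ℝ} (hl : 3.559800513486339340129810096526 ≤ lam)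
    (hu : lam ≤ 3.559800513486339340129810096527) :
    0.8317963967344406899938931 ≤ Real.logb 2 lam - 1 ∧
      Real.logb 2 lam - 1 < 0.8317963967344406899938932 := by
  constructor
  · refine le_logb_sub_one (x := 0.280549726505969148837210873422) 26 (by norm_num) (by norm_num)
      (le_trans (by norm_num) hl) (by norm_num) ?_
    norm_num [Finset.sum_range_succ]
  · refine logb_sub_one_lt (x := 0.280549726505969148837210873423) 26 (by norm_num) (by norm_num)
      (by linarith) (hu.trans (by norm_num)) (by norm_num) ?_
    norm_num [Finset.sum_range_succ]

end OddEntries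

end


/-! ### The ten families together -/

theorem mainTheorem6 :
    -- `(1 + x)^n`
    (HasSpectralExponent (gCount 1) (fD0 + fD1) (Real.logb 2 (3 / 2)) ∧
      IsDominantEigenvalue (fD0 + fD1) 3) ∧
    -- `(1 + x + x²)^n`
    (HasSpectralExponent (gCount 2) (gD0 + gD1) (Real.logb 2 Real.goldenRatio) ∧
      IsDominantEigenvalue (gD0 + gD1) ((1 + √5 : ℝ) : ℂ)) ∧
    -- `(1 + x + x² + x³)^n`
    (HasSpectralExponent (gCount 3) (g3D0 + g3D1) (Real.logb 2 (3 / 2)) ∧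
      IsDominantEigenvalue (g3D0 + g3D1) 3) ∧
    -- `(1 + x + x³)^n`
    (∃ L : ℝ, HasSpectralExponent (hCount 3) (h3D0 + h3D1) L ∧
      0.7274509132400228143266172 ≤ L ∧ L < 0.7274509132400228143266173 ∧
      ∀ μ : ℂ, IsEigenvalue (h3D0 + h3D1) μ →
        minpoly ℚ μ = X ^ 4 - 3 * X ^ 3 - 2 * X ^ 2 + 2 * X + 4) ∧
    -- `(1 + x + x² + x³ + x⁴)^n`
    (∃ L : ℝ, HasSpectralExponent (gCount 4) (g4D0 + g4D1) L ∧
      0.7896418505307685639015472 ≤ L ∧ L < 0.7896418505307685639015473 ∧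
      ∀ μ : ℂ, IsEigenvalue (g4D0 + g4D1) μ →
        minpoly ℚ μ = X ^ 4 - X ^ 3 - 6 * X ^ 2 - 4 * X - 16) ∧
    -- `(1 + x + x⁴)^n`
    (∃ L : ℝ, HasSpectralExponent (hCount 4) (h4D0 + h4D1) L ∧
      0.736 ≤ L ∧ L < 0.737) ∧
    -- `(1 + x + ⋯ + x⁵)^n`
    (∃ L : ℝ, HasSpectralExponent (gCount 5) (g5D0 + g5D1) L ∧
      0.8194694621655401465959376 ≤ L ∧ L < 0.8194694621655401465959377 ∧
      ∀ μ : ℂ, IsEigenvalue (g5D0 + g5D1) μ →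
        minpoly ℚ μ = X ^ 6 - 4 * X ^ 5 + X ^ 4 - X ^ 3 + 8 * X ^ 2 + 11 * X + 8) ∧
    -- `(1 + x + ⋯ + x⁶)^n`
    (∃ L : ℝ, HasSpectralExponent (gCount 6) (g6D0 + g6D1) L ∧
      0.8317963967344406899938931 ≤ L ∧ L < 0.8317963967344406899938932 ∧
      ∀ μ : ℂ, IsEigenvalue (g6D0 + g6D1) μ →
        minpoly ℚ μ = X ^ 6 - X ^ 5 - 2 * X ^ 4 - 28 * X ^ 3 + 16 * X + 64) ∧
    -- Pascal's rhombus
    (HasSpectralExponent uCount (uD0 + uD1) (Real.logb 2 ((3 + √17) / 4)) ∧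
      IsDominantEigenvalue (uD0 + uD1) (((3 + √17) / 2 : ℝ) : ℂ)) ∧
    -- the Fibonacci polynomials
    (HasSpectralExponent vCount (vD0 + vD1) (Real.logb 2 (3 / 2)) ∧
      IsDominantEigenvalue (vD0 + vD1) 3) := by
  have three_halves : Real.logb 2 (3 / 2) = Real.logb 2 3 - 1 := by
    rw [Real.logb_div (by norm_num) (by norm_num), Real.logb_self_eq_one one_lt_two]
  refine ⟨?_, ?_, ?_, ?_, ?_, ?_, ?_, ?_, ?_, ?_⟩
  · simpa only [three_halves, Complex.ofReal_ofNat] using hasSpectralExponent_f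
  · have h5 : √5 ^ 2 = 5 := Real.sq_sqrt (by norm_num)
    have h0 : 0 ≤ √5 := Real.sqrt_nonneg 5
    have e : Real.logb 2 Real.goldenRatio = Real.logb 2 (1 + √5) - 1 := by
      rw [Real.goldenRatio, Real.logb_div (by positivity) (by norm_num),
        Real.logb_self_eq_one one_lt_two]
    rw [e]
    exact hasSpectralExponent_g (by nlinarith) (by nlinarith) (by linarith)
  · simpa only [three_halves, Complex.ofReal_ofNat] using hasSpectralExponent_g3
  · obtain ⟨lam, hl, hu, h⟩ := exists_root_h3
    obtain ⟨hlow, hup⟩ := logb_bounds_h3 hl hu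
    exact ⟨_, (hasSpectralExponent_h3 (by linarith) (by linarith) h).1, hlow, hup, fun μ => minpoly_h3⟩
  · obtain ⟨lam, hl, hu, h⟩ := exists_root_g4
    obtain ⟨hlow, hup⟩ := logb_bounds_g4 hl hu
    exact ⟨_, (hasSpectralExponent_g4 (by linarith) (by linarith) h).1, hlow, hup, fun μ => minpoly_g4⟩
  · obtain ⟨lam, hl, hu, h⟩ := exists_root_h4
    obtain ⟨hlow, hup⟩ := logb_bounds_h4 hl hu
    exact ⟨_, (hasSpectralExponent_h4 (by linarith) (by linarith) h).1, hlow, hup⟩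
  · obtain ⟨lam, hl, hu, h⟩ := exists_root_g5
    obtain ⟨hlow, hup⟩ := logb_bounds_g5 hl hu
    exact ⟨_, (hasSpectralExponent_g5 (by linarith) (by linarith) h).1, hlow, hup, fun μ => minpoly_g5⟩
  · obtain ⟨lam, hl, hu, h⟩ := exists_root_g6
    obtain ⟨hlow, hup⟩ := logb_bounds_g6 hl hu
    exact ⟨_, (hasSpectralExponent_g6 (by linarith) (by linarith) h).1, hlow, hup, fun μ => minpoly_g6⟩
  · have h17 : √17 ^ 2 = 17 := Real.sq_sqrt (by norm_num)
    have h0 : 0 ≤ √17 := Real.sqrt_nonneg 17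
    have e : Real.logb 2 ((3 + √17) / 4) = Real.logb 2 ((3 + √17) / 2) - 1 := by
      rw [show (3 + √17) / 4 = (3 + √17) / 2 / 2 by ring,
        Real.logb_div (by positivity) (by norm_num), Real.logb_self_eq_one one_lt_two]
    rw [e]
    exact hasSpectralExponent_uCount (by linarith) (by nlinarith)
  · simpa only [three_halves, Complex.ofReal_ofNat] using hasSpectralExponent_vCount
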